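/- \textbf{Conventions.} A decision problem is a set of instances, represented injectively by words over a finite alphabet, with a distinguished set of yes-instances. Write $A\le_p B$ if there is a polynomial-time (Turing machine) computable map from instances of $A$ to instances of $B$ that preserves both yes- and no-instances. A polynomial in $\mathbb Z[x_1,\dots,x_d]$ is given explicitly as a sum of terms, each consisting of an integer coefficient and a vector of $d$ exponents, all written in binary, with $d$ in unary. Let $\mathrm{ETR}$ be the problem of deciding whether a sentence $\exists x_1\cdots\exists x_n\,\Phi(x_1,\dots,x_n)$ is true over $\mathbb R$, where $\Phi$ is a quantifier-free Boolean combination of polynomial equations and inequalities with integer coefficients. The class $\exists\mathbb R$ consists of all decision problems $A$ with $A\le_p\mathrm{ETR}$, and a decision problem $B$ is $\exists\mathbb R$-hard if $A\le_p B$ for every $A\in\exists\mathbb R$. For a fixed integer $k$, an instance of $\mathrm{CLSC}\text{-}k$ is a polynomial $f\in\mathbb Z[x_1,\dots,x_d]$ together with a rational threshold $\theta>0$; the question is whether $L_\theta=\{x\in\mathbb R^d : f(x)\ge\theta\}$ has at least $k$ connected components. \textbf{Theorem (Hardness of CLSC-$k$).} For every fixed $k\ge 2$, $\mathrm{CLSC}\text{-}k$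 is $\exists\mathbb R$-hard. Moreover, let $m\ge 0$, let $r\in\mathbb Z[y_1,\dots,y_m]$, and let $V(r)=\{y\in\mathbb R^m : r(y)=0\}$. \begin{enumerate} \item For the two-sheet polynomial $F(y,s)=1-\bigl[r(y)^2+(s^2-1)^2\bigr]$ one has $\{F\ge 1\}=V(r)\times\{1,-1\}$, and this set has at least $2$ connected components if and only if $V(r)\neq\varnothing$. \item For every $k\ge2$ and the polynomial $F_k=1-\sum_{i=1}^{k-1}\bigl[r(y^{(i)})^2+((s^{(i)})^2-1)^2\bigr]$ in $k-1$ independent copies of the variables $(y,s)$, one has $\{F_k\ge 1\}=(V(r)\times\{1,-1\})^{k-1}$. If $V(r)\ne\varnothing$, this set has at least $2^{k-1}$ connected components; and it has at least $k$ connected components if and only if $V(r)\neq\varnothing$. \end{enumerate} -/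

import Mathlib

namespace ContinuousClustering

/-! ### Decision problems, polynomial-time reductions -/

/-- A decision problem: instances, written as words over a finite alphabet, together with the
set of yes-instances. -/
structure DecisionProblem where
  /-- the instances -/
  Inst : Type
  /-- the alphabet -/
  Symb : Type
  /-- the alphabet is finite -/
  finSymb : Fintype Symb
  /-- the word that represents an instance -/
  encode : Inst → List Symb
  /-- a word represents at most one instance -/
  encode_injective : Function.Injective encode
  /-- the yes-instances -/
  Yes : Inst → Prop

/-- Polynomial-time many-one reducibility, by (multi-stack) Turing machines whose number of steps
is bounded by a polynomial in the length of the input word. -/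
def PolyTimeReducible (A B : DecisionProblem) : Prop :=
  ∃ f : A.Inst → B.Inst,
    Nonempty (Turing.TM2ComputableInPolyTime A.encode B.encode f) ∧
      ∀ a, A.Yes a ↔ B.Yes (f a)

/-! ### Explicit polynomials -/

/-- An explicit sum of monomials in `d` variables: each term is an integer coefficient together
with the vector of its `d` exponents. -/
abbrev PolyCode (d : ℕ) : Type := List (ℤ × (Fin d → ℕ))

/-- The polynomial in `ℤ[x₁, …, x_d]` that an explicit sum of monomials denotes. -/
noncomputable def PolyCode.toPoly {d : ℕ} (p : PolyCode d) : MvPolynomial (Fin d) ℤ :=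
  (p.map fun t => MvPolynomial.monomial (Finsupp.equivFunOnFinite.symm t.2) t.1).sum

/-- The alphabet in which instances are written. -/
inductive Sym : Type
  | bit (b : Bool)
  | tick
  | minus
  | sep
  | term
  | endPoly
  | eqZero
  | nonneg
  | pos
  | not
  | and
  | or
  deriving DecidableEq, Fintype

/-- Natural numbers in binary, closed by a separator. -/
def encNat (n : ℕ) : List Sym := (Computability.encodeNat n).map Sym.bit ++ [Sym.sep]

/-- Integers: a minus sign if negative, then the absolute value in binary. -/
def encInt (z : ℤ) : List Sym := (if z < 0 then [Sym.minus] else []) ++ encNat z.natAbs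

/-- Rational numbers: numerator, then denominator. -/
def encRat (q : ℚ) : List Sym := encInt q.num ++ encNat q.den

/-- The number of variables, in unary. -/
def encDim (d : ℕ) : List Sym := List.replicate d Sym.tick ++ [Sym.sep]

/-- A list of exponents, each in binary. -/
def encNats (l : List ℕ) : List Sym := l.flatMap encNat

/-- One term: its coefficient, then its `d` exponents, all in binary. -/
def encTerm {d : ℕ} (t : ℤ × (Fin d → ℕ)) : List Sym :=
  encInt t.1 ++ encNats (List.ofFn t.2)

/-- An explicit sum of monomials, term by term. -/
def encPoly {d : ℕ} (p : PolyCode d) : List Sym :=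
  p.flatMap (fun t => Sym.term :: encTerm t) ++ [Sym.endPoly]

/-! ### The existential theory of the reals -/

/-- Quantifier-free Boolean combinations of polynomial equations and inequalities with integer
coefficients, in `n` variables. (The relations `<`, `≤`, `≠` arise by changing the signs of the
coefficients and by negation.) -/
inductive QFFormula (n : ℕ) : Type
  | eqZero (p : PolyCode n)
  | nonneg (p : PolyCode n)
  | pos (p : PolyCode n)
  | not (φ : QFFormula n)
  | and (φ ψ : QFFormula n)
  | or (φ ψ : QFFormula n)

/-- Truth of a quantifier-free formula at a real point. -/
def QFFormula.Holds {n : ℕ} (x : Fin n → ℝ) : QFFormula n → Prop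
  | .eqZero p => MvPolynomial.aeval x p.toPoly = 0
  | .nonneg p => 0 ≤ MvPolynomial.aeval x p.toPoly
  | .pos p => 0 < MvPolynomial.aeval x p.toPoly
  | .not φ => ¬ φ.Holds x
  | .and φ ψ => φ.Holds x ∧ ψ.Holds x
  | .or φ ψ => φ.Holds x ∨ ψ.Holds x

/-- Formulas are written in prefix notation. -/
def encFormula {n : ℕ} : QFFormula n → List Sym
  | .eqZero p => Sym.eqZero :: encPoly p
  | .nonneg p => Sym.nonneg :: encPoly p
  | .pos p => Sym.pos :: encPoly p
  | .not φ => Sym.not :: encFormula φ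
  | .and φ ψ => Sym.and :: (encFormula φ ++ encFormula ψ)
  | .or φ ψ => Sym.or :: (encFormula φ ++ encFormula ψ)

/-- An existential sentence `∃ x₁ … ∃ x_n, Φ(x₁, …, x_n)`. -/
structure ExistsSentence where
  /-- the number of variables -/
  n : ℕ
  /-- the matrix -/
  matrix : QFFormula n

/-- The word of an existential sentence. -/
def encSentence (s : ExistsSentence) : List Sym := encDim s.n ++ encFormula s.matrix

/-! ### Super-level sets and their components -/

/-- The super-level set `{x | f(x) ≥ θ}`. -/
def superLevel {σ : Type} (f : MvPolynomial σ ℤ) (θ : ℝ) : Set (σ → ℝ) :=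
  {x | θ ≤ MvPolynomial.aeval x f}

/-- The number of connected components of a set, as a subspace. -/
noncomputable def numComponents {X : Type} [TopologicalSpace X] (S : Set X) : ℕ∞ :=
  ENat.card (ConnectedComponents S)

/-- An instance of component counting: an explicit polynomial with integer coefficients and a
positive rational threshold. -/
structure LevelInstance where
  /-- the number of variables -/
  d : ℕ
  /-- the polynomial -/
  f : PolyCode d
  /-- the threshold -/
  θ : ℚ
  /-- the threshold is positive -/
  θ_pos : 0 < θ

/-- The word of an instance of component counting. -/
def encLevel (i : LevelInstance) : List Sym := encDim i.d ++ encRat i.θ ++ encPoly i.f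

/-! ### Unique readability of the encodings -/

theorem encDim_read {a b : ℕ} {s t : List Sym} (h : encDim a ++ s = encDim b ++ t) :
    a = b ∧ s = t := by
  induction a generalizing b with
  | zero =>
    cases b with
    | zero => simpa [encDim] using h
    | succ b => simp [encDim, List.replicate_succ] at h
  | succ a ih =>
    cases b with
    | zero => simp [encDim, List.replicate_succ] at h
    | succ b =>
      have h' : encDim a ++ s = encDim b ++ t := by
        simpa [encDim, List.replicate_succ] using h
      obtain ⟨h1, h2⟩ := ih h'
      exact ⟨by rw [h1], h2⟩

theorem bits_read {a b : List Bool} {s t : List Sym}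
    (h : a.map Sym.bit ++ Sym.sep :: s = b.map Sym.bit ++ Sym.sep :: t) : a = b ∧ s = t := by
  induction a generalizing b with
  | nil => cases b <;> simp_all
  | cons x a ih =>
    cases b with
    | nil => simp at h
    | cons y b =>
      simp only [List.map_cons, List.cons_append, List.cons.injEq, Sym.bit.injEq] at h
      obtain ⟨h1, h2⟩ := ih h.2
      exact ⟨by rw [h.1, h1], h2⟩

theorem encNat_read {a b : ℕ} {s t : List Sym} (h : encNat a ++ s = encNat b ++ t) :
    a = b ∧ s = t := by
  obtain ⟨h1, h2⟩ := bits_read (a := Computability.encodeNat a) (b := Computability.encodeNat b)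
    (s := s) (t := t) (by simpa [encNat] using h)
  refine ⟨?_, h2⟩
  rw [← Computability.decode_encodeNat a, ← Computability.decode_encodeNat b, h1]

theorem encNat_head {n : ℕ} {s t : List Sym} : encNat n ++ s ≠ Sym.minus :: t := by
  unfold encNat
  cases Computability.encodeNat n <;> simp

theorem encInt_read {a b : ℤ} {s t : List Sym} (h : encInt a ++ s = encInt b ++ t) :
    a = b ∧ s = t := by
  unfold encInt at h
  by_cases ha : a < 0 <;> by_cases hb : b < 0
  · simp only [ha, hb, if_true, List.cons_append, List.nil_append, List.cons.injEq,
      true_and] at h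
    obtain ⟨h1, h2⟩ := encNat_read h
    exact ⟨by omega, h2⟩
  · simp only [ha, hb, if_true, if_false, List.cons_append, List.nil_append] at h
    exact absurd h.symm encNat_head
  · simp only [ha, hb, if_true, if_false, List.cons_append, List.nil_append] at h
    exact absurd h encNat_head
  · simp only [ha, hb, if_false, List.nil_append] at h
    obtain ⟨h1, h2⟩ := encNat_read h
    exact ⟨by omega, h2⟩

theorem encRat_read {a b : ℚ} {s t : List Sym} (h : encRat a ++ s = encRat b ++ t) :
    a = b ∧ s = t := by
  unfold encRat at h
  rw [List.append_assoc, List.append_assoc] at h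
  obtain ⟨h1, h2⟩ := encInt_read h
  obtain ⟨h3, h4⟩ := encNat_read h2
  exact ⟨Rat.ext h1 h3, h4⟩

theorem encNats_read {a b : List ℕ} (hl : a.length = b.length) {s t : List Sym}
    (h : encNats a ++ s = encNats b ++ t) : a = b ∧ s = t := by
  induction a generalizing b with
  | nil =>
    cases b with
    | nil => simpa [encNats] using h
    | cons y b => simp at hl
  | cons x a ih =>
    cases b with
    | nil => simp at hl
    | cons y b =>
      simp only [encNats, List.flatMap_cons, List.append_assoc] at h
      obtain ⟨h1, h2⟩ := encNat_read h
      obtain ⟨h3, h4⟩ := ih (by simpa using hl) h2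
      exact ⟨by rw [h1, h3], h4⟩

theorem encTerm_read {d : ℕ} {a b : ℤ × (Fin d → ℕ)} {s t : List Sym}
    (h : encTerm a ++ s = encTerm b ++ t) : a = b ∧ s = t := by
  unfold encTerm at h
  rw [List.append_assoc, List.append_assoc] at h
  obtain ⟨h1, h2⟩ := encInt_read h
  obtain ⟨h3, h4⟩ := encNats_read (by simp) h2
  exact ⟨Prod.ext h1 (List.ofFn_injective h3), h4⟩

theorem encPoly_read {d : ℕ} {a b : PolyCode d} {s t : List Sym}
    (h : encPoly a ++ s = encPoly b ++ t) : a = b ∧ s = t := by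
  induction a generalizing b with
  | nil =>
    cases b with
    | nil => simpa [encPoly] using h
    | cons y b => simp [encPoly] at h
  | cons x a ih =>
    cases b with
    | nil => simp [encPoly] at h
    | cons y b =>
      have h' : encTerm x ++ (encPoly a ++ s) = encTerm y ++ (encPoly b ++ t) := by
        simpa [encPoly] using h
      obtain ⟨h1, h2⟩ := encTerm_read h'
      obtain ⟨h3, h4⟩ := ih h2
      exact ⟨by rw [h1, h3], h4⟩

theorem encFormula_read {n : ℕ} {a b : QFFormula n} {s t : List Sym}
    (h : encFormula a ++ s = encFormula b ++ t) : a = b ∧ s = t := by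
  induction a generalizing b s t with
  | eqZero p | nonneg p | pos p =>
    cases b <;> simp [encFormula] at h
    obtain ⟨h1, h2⟩ := encPoly_read h
    exact ⟨by rw [h1], h2⟩
  | not φ ih =>
    cases b <;> simp [encFormula] at h
    obtain ⟨h1, h2⟩ := ih h
    exact ⟨by rw [h1], h2⟩
  | and φ ψ ih1 ih2 | or φ ψ ih1 ih2 =>
    cases b <;> simp [encFormula] at h
    obtain ⟨h1, h2⟩ := ih1 h
    obtain ⟨h3, h4⟩ := ih2 h2
    exact ⟨by rw [h1, h3], h4⟩

theorem encSentence_injective : Function.Injective encSentence := by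
  rintro ⟨n, φ⟩ ⟨m, ψ⟩ h
  obtain ⟨h1, h2⟩ := encDim_read h
  dsimp only at h1 h2
  subst h1
  obtain ⟨h3, -⟩ := encFormula_read (s := []) (t := []) (by simpa using h2)
  rw [h3]

theorem encLevel_injective : Function.Injective encLevel := by
  rintro ⟨d, f, θ, hθ⟩ ⟨d', f', θ', hθ'⟩ h
  unfold encLevel at h
  rw [List.append_assoc, List.append_assoc] at h
  obtain ⟨h1, h2⟩ := encDim_read h
  dsimp only at h1 h2
  subst h1
  obtain ⟨h3, h4⟩ := encRat_read h2
  subst h3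
  obtain ⟨h5, -⟩ := encPoly_read (s := []) (t := []) (by simpa using h4)
  rw [h5]

/-! ### The class `∃ℝ` and the problem CLSC-`k` -/

/-- The existential theory of the reals, as a decision problem. -/
def ETR : DecisionProblem where
  Inst := ExistsSentence
  Symb := Sym
  finSymb := inferInstance
  encode := encSentence
  encode_injective := encSentence_injective
  Yes s := ∃ x : Fin s.n → ℝ, s.matrix.Holds x

/-- Membership in the class `∃ℝ`. -/
def InExistsR (A : DecisionProblem) : Prop := PolyTimeReducible A ETR

/-- Hardness for the class `∃ℝ`. -/
def ExistsRHard (B : DecisionProblem) : Prop :=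
  ∀ A : DecisionProblem, InExistsR A → PolyTimeReducible A B

/-- CLSC-`k`: does `{x ∈ ℝ^d | f(x) ≥ θ}` have at least `k` connected components? -/
def CLSC (k : ℕ) : DecisionProblem where
  Inst := LevelInstance
  Symb := Sym
  finSymb := inferInstance
  encode := encLevel
  encode_injective := encLevel_injective
  Yes i := (k : ℕ∞) ≤ numComponents (superLevel i.f.toPoly (i.θ : ℝ))

/-! ### The two-sheet polynomial -/

/-- The penalty `r(y)² + (s² - 1)²` in the variables `y` (indices `some j`) and `s` (index
`none`). -/
noncomputable def sheetPenalty {m : ℕ} (r : MvPolynomial (Fin m) ℤ) :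
    MvPolynomial (Option (Fin m)) ℤ :=
  MvPolynomial.rename some r ^ 2 + (MvPolynomial.X none ^ 2 - 1) ^ 2

/-- The two-sheet polynomial `1 - [r(y)² + (s² - 1)²]`. -/
noncomputable def twoSheet {m : ℕ} (r : MvPolynomial (Fin m) ℤ) :
    MvPolynomial (Option (Fin m)) ℤ :=
  1 - sheetPenalty r

/-- The polynomial `1 - ∑ᵢ [r(y⁽ⁱ⁾)² + ((s⁽ⁱ⁾)² - 1)²]` on `n` independent copies of the
variables. -/
noncomputable def twoSheetCopies (n : ℕ) {m : ℕ} (r : MvPolynomial (Fin m) ℤ) :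
    MvPolynomial (Fin n × Option (Fin m)) ℤ :=
  1 - ∑ i : Fin n, MvPolynomial.rename (fun v => (i, v)) (sheetPenalty r)

/-- The real zero set `V(r)`. -/
def realZeros {m : ℕ} (r : MvPolynomial (Fin m) ℤ) : Set (Fin m → ℝ) :=
  {y | MvPolynomial.aeval y r = 0}

/-- The set `V(r) × {1, -1}`, the last coordinate being the one with index `none`. -/
def sheets {m : ℕ} (r : MvPolynomial (Fin m) ℤ) : Set (Option (Fin m) → ℝ) :=
  {x | (fun j => x (some j)) ∈ realZeros r ∧ (x none = 1 ∨ x none = -1)}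

end ContinuousClustering

/-!
Give every letter of the word of an existential sentence, enclosed by a first and a last letter,
three real registers. A formula is evaluated by its word read from right to left: coefficients by
Horner's rule, powers of variables by repeated squaring, then terms, polynomials and truth values.
Each step is a polynomial equation between the registers of a letter and those of at most three
others: the next letter, the second operand of a connective, the variable to which an exponent
belongs. A strict or weak inequality, or its failure, becomes such an equation with the help of a
real witness. If `E` is the sum of the squares of these equations, including the one which says that
the whole formula is true, and `s` is a register of the first letter, which no equation involves,
then `{1 - E - (s (s - 1) ⋯ (s - (k - 1))) ^ 2 ≥ 1}` is empty if the sentence is false, and is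
otherwise mapped continuously onto the `k` points `0, …, k - 1` by `s`.

The monomials of this polynomial are boundedly many per letter, and the exponent vector of each
depends only on which letters are the next letter, the operand and the variable of a given one. They
are listed by running through all choices of a letter. For each choice, two passes over the word by
a finite-state machine with one counter find these letters: to the right, counting the connectives
whose operands are still to come finds the operand; to the left, the number of exponents that follow
in the term finds the variable.
-/

namespace ContinuousClustering

section Machines

open Turing Function

/-! ### Runs of bounded length -/

/-- `RunsIn f t a b`: iterating the partial map `f` leads from `a` to `b` in at most `t` steps. -/
inductive RunsIn {σ : Type*} (f : σ → Option σ) : ℕ → σ → σ → Prop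
  | refl (t : ℕ) (a : σ) : RunsIn f t a a
  | head {t : ℕ} {a b c : σ} (step : f a = some b) (run : RunsIn f t b c) : RunsIn f (t + 1) a c

namespace RunsIn

variable {σ τ : Type*} {f : σ → Option σ} {g : τ → Option τ} {s t : ℕ} {a b c : σ}

theorem single (h : f a = some b) : RunsIn f 1 a b := head h (refl 0 b)

theorem mono (h : RunsIn f s a b) (hst : s ≤ t) : RunsIn f t a b := by
  induction h generalizing t with
  | refl => exact refl t _
  | head step _ ih =>
    obtain ⟨t, rfl⟩ := Nat.exists_eq_add_of_lt (Nat.lt_of_succ_le hst)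
    exact head step (ih (by omega))

theorem trans (h : RunsIn f s a b) (h' : RunsIn f t b c) : RunsIn f (s + t) a c := by
  induction h with
  | refl => exact h'.mono (Nat.le_add_left _ _)
  | head step _ ih => exact (head step (ih h')).mono (by omega)

theorem map (φ : σ → τ) (hφ : ∀ a b, f a = some b → g (φ a) = some (φ b)) (h : RunsIn f t a b) :
    RunsIn g t (φ a) (φ b) := by
  induction h with
  | refl => exact refl _ _
  | head step _ ih => exact head (hφ _ _ step) ih

theorem size_le (size : σ → ℕ) (c : ℕ) (hc : ∀ a b, f a = some b → size b ≤ size a + c)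
    (h : RunsIn f t a b) : size b ≤ size a + c * t := by
  induction h with
  | refl => exact Nat.le_add_right _ _
  | head step _ ih => exact ih.trans (by rw [Nat.mul_succ]; have := hc _ _ step; omega)

theorem foldl {ι β : Type*} (cfg : List ι → β → σ) (g : β → ι → β) (n : ℕ)
    (hstep : ∀ i l b, RunsIn f n (cfg (i :: l) b) (cfg l (g b i))) (l : List ι) (b : β) :
    RunsIn f (n * l.length) (cfg l b) (cfg [] (l.foldl g b)) := by
  induction l generalizing b with
  | nil => exact refl _ _
  | cons i l ih =>
    exact ((hstep i l b).trans (ih (g b i))).mono (by rw [List.length_cons, Nat.mul_succ]; omega)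

theorem transfer {ι κ : Type*} (cfg : List ι → List κ → σ) (g : ι → κ) (n : ℕ)
    (hstep : ∀ i l r, RunsIn f n (cfg (i :: l) r) (cfg l (g i :: r))) (l : List ι) (r : List κ) :
    RunsIn f (n * l.length) (cfg l r) (cfg [] ((l.map g).reverse ++ r)) := by
  convert foldl cfg (fun r i => g i :: r) n hstep l r using 2
  induction l generalizing r with
  | nil => rfl
  | cons i l ih => simp [← ih]

theorem iff_nonempty_evalsToInTime :
    RunsIn f t a b ↔ Nonempty (StateTransition.EvalsToInTime f a (some b) t) := by
  refine ⟨fun h => ?_, ?_⟩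
  · induction h with
    | refl t a => exact ⟨⟨⟨0, rfl⟩, Nat.zero_le t⟩⟩
    | head step _ ih =>
      obtain ⟨⟨n, e⟩, hn⟩ := ih
      refine ⟨⟨⟨n + 1, ?_⟩, Nat.succ_le_succ hn⟩⟩
      rw [iterate_succ_apply, ← e, ← step]
      rfl
  · rintro ⟨⟨n, e⟩, hn⟩
    suffices RunsIn f n a b from this.mono hn
    clear hn
    induction n generalizing a with
    | zero => exact Option.some.inj e ▸ refl 0 a
    | succ n ih =>
      rw [iterate_succ_apply] at e
      change (flip bind f)^[n] (f a) = some b at e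
      cases step : f a with
      | none => rw [step, iterate_fixed (show flip bind f none = none from rfl)] at e; cases e
      | some a' => exact head step (ih (step ▸ e))

end RunsIn

/-! ### Polynomial time -/

/-- Polynomial-time computability of `f` with respect to the encodings `ea` and `eb`, as a
proposition. -/
def PolyTime {α β αΓ βΓ : Type} (ea : α → List αΓ) (eb : β → List βΓ) (f : α → β) : Prop :=
  Nonempty (TM2ComputableInPolyTime ea eb f)

theorem initList_eq_update (tm : FinTM2) (s : List (tm.Γ tm.k₀)) :
    initList tm s = ⟨some tm.main, tm.initialState, update (fun _ => []) tm.k₀ s⟩ := by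
  unfold initList
  congr 1
  funext k
  by_cases h : k = tm.k₀
  · subst h; simp
  · simp [h]

theorem haltList_eq_update (tm : FinTM2) (s : List (tm.Γ tm.k₁)) :
    haltList tm s = ⟨none, tm.initialState, update (fun _ => []) tm.k₁ s⟩ := by
  unfold haltList
  congr 1
  funext k
  by_cases h : k = tm.k₁
  · subst h; simp
  · simp [h]

/-- The machine `tm` turns the word `s` into the word `w` in at most `t` steps. -/
def Outputs (tm : FinTM2) (t : ℕ) (s : List (tm.Γ tm.k₀)) (w : List (tm.Γ tm.k₁)) : Prop :=
  RunsIn (TM2.step tm.m) t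
    ⟨some tm.main, tm.initialState, update (fun _ => []) tm.k₀ s⟩
    ⟨none, tm.initialState, update (fun _ => []) tm.k₁ w⟩

theorem outputs_iff {tm : FinTM2} {t : ℕ} {s : List (tm.Γ tm.k₀)} {w : List (tm.Γ tm.k₁)} :
    Outputs tm t s w ↔ Nonempty (TM2OutputsInTime tm s (some w) t) := by
  unfold Outputs TM2OutputsInTime
  rw [initList_eq_update, Option.map_some, haltList_eq_update]
  exact RunsIn.iff_nonempty_evalsToInTime

section PolyTime

variable {α β γ αΓ βΓ γΓ : Type} {ea : α → List αΓ} {eb : β → List βΓ} {ec : γ → List γΓ}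
  {f : α → β}

theorem PolyTime.of_outputs (tm : FinTM2) (e₀ : tm.Γ tm.k₀ ≃ αΓ) (e₁ : tm.Γ tm.k₁ ≃ βΓ)
    (p : Polynomial ℕ)
    (h : ∀ a, Outputs tm (p.eval (ea a).length) ((ea a).map e₀.symm) ((eb (f a)).map e₁.symm)) :
    PolyTime ea eb f :=
  ⟨⟨⟨tm, e₀, e₁⟩, p, fun a => Classical.choice (outputs_iff.1 (h a))⟩⟩

theorem PolyTime.id_of_outputs (tm : FinTM2) {F : List (tm.Γ tm.k₀) → List (tm.Γ tm.k₁)}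
    (p : Polynomial ℕ) (h : ∀ l, Outputs tm (p.eval l.length) l (F l)) : PolyTime id id F :=
  .of_outputs tm (.refl _) (.refl _) p fun l => by simpa using h l

theorem PolyTime.of_comp_encode {F : List αΓ → List βΓ} (hF : PolyTime id id F)
    (h : ∀ a, F (ea a) = eb (f a)) : PolyTime ea eb f := by
  obtain ⟨⟨aux, p, run⟩⟩ := hF
  exact ⟨⟨aux, p, fun a => by simpa [h] using run (ea a)⟩⟩

theorem outputs_of_computable (h : TM2ComputableInPolyTime ea eb f) (a : α) :
    Outputs h.tm (h.time.eval (ea a).length) ((ea a).map h.inputAlphabet.symm)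
      ((eb (f a)).map h.outputAlphabet.symm) :=
  outputs_iff.2 ⟨h.outputsFun a⟩

/-- The number of `push` instructions of a statement: the most by which it lengthens a stack. -/
def pushCount {K : Type*} {Γ : K → Type*} {Λ σ : Type*} : TM2.Stmt Γ Λ σ → ℕ
  | .push _ _ q => pushCount q + 1
  | .peek _ _ q => pushCount q
  | .pop _ _ q => pushCount q
  | .load _ q => pushCount q
  | .branch _ q₁ q₂ => pushCount q₁ + pushCount q₂
  | .goto _ => 0
  | .halt => 0

theorem length_stepAux_le {K : Type*} [DecidableEq K] {Γ : K → Type*} {Λ σ : Type*}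
    (q : TM2.Stmt Γ Λ σ) (v : σ) (S : ∀ k, List (Γ k)) (k : K) :
    ((TM2.stepAux q v S).stk k).length ≤ (S k).length + pushCount q := by
  induction q generalizing v S with
  | push k' _ _ ih =>
    refine (ih _ _).trans ?_
    rcases eq_or_ne k k' with rfl | h
    · simp only [update_self, List.length_cons, pushCount]; omega
    · simp only [update_of_ne h, pushCount]; omega
  | peek _ _ _ ih => exact ih _ _
  | pop k' _ _ ih =>
    refine (ih _ _).trans ?_
    rcases eq_or_ne k k' with rfl | h
    · simp [pushCount]
    · simp [update_of_ne h, pushCount]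
  | load _ _ ih => exact ih _ _
  | branch p _ _ ih₁ ih₂ =>
    simp only [TM2.stepAux, pushCount]
    cases p v
    · exact (ih₂ _ _).trans (by omega)
    · exact (ih₁ _ _).trans (by omega)
  | goto => simp [TM2.stepAux, pushCount]
  | halt => simp [TM2.stepAux, pushCount]

theorem exists_length_encode_le (h : TM2ComputableInPolyTime ea eb f) :
    ∃ c : ℕ, ∀ a, (eb (f a)).length ≤ (ea a).length + c * h.time.eval (ea a).length := by
  let _ := h.tm.ΛFin
  let c := Finset.univ.sup fun l => pushCount (h.tm.m l)
  refine ⟨c, fun a => ?_⟩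
  have step_le : ∀ x y, TM2.step h.tm.m x = some y →
      (y.stk h.tm.k₁).length ≤ (x.stk h.tm.k₁).length + c := by
    rintro ⟨_ | l, v, S⟩ y hy
    · cases hy
    · cases hy
      exact (length_stepAux_le _ _ _ _).trans (Nat.add_le_add_left
        (Finset.le_sup (f := fun l => pushCount (h.tm.m l)) (Finset.mem_univ l)) _)
  have output_le := (outputs_of_computable h a).size_le (fun x => (x.stk h.tm.k₁).length) c step_le
  simp only [update_self, List.length_map] at output_le
  refine output_le.trans (Nat.add_le_add_right ?_ _)
  by_cases e : h.tm.k₁ = h.tm.k₀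
  · rw [e]; simp
  · simp [e]

end PolyTime

/-! ### Composition of machines -/

namespace Comp

/-- The stack alphabets of the composite machine: those of the two machines and, between them, a
stack for the word that is handed over. -/
abbrev StackAlphabet {K₁ K₂ : Type} (Γ₁ : K₁ → Type) (B : Type) (Γ₂ : K₂ → Type) :
    K₁ ⊕ (Unit ⊕ K₂) → Type
  | .inl k => Γ₁ k
  | .inr (.inl _) => B
  | .inr (.inr k) => Γ₂ k

/-- Labels of the composite machine: those of the two machines, and between them the labels of the
two loops that hand over the word, which carry the letter that is in transit. -/
abbrev Label (Λ₁ B Λ₂ : Type) := Λ₁ ⊕ ((Option B ⊕ Option B) ⊕ Λ₂)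

/-- Internal states of the composite machine; the last component receives the letters that are
handed over. -/
abbrev State (σ₁ σ₂ B : Type) := σ₁ × σ₂ × Option B

variable {K₁ K₂ : Type} {Γ₁ : K₁ → Type} {B : Type} {Γ₂ : K₂ → Type}
  {Λ₁ Λ₂ σ₁ σ₂ : Type}

/-- The stacks of the composite machine. -/
def contents (S : ∀ k, List (Γ₁ k)) (l : List B) (T : ∀ k, List (Γ₂ k)) :
    ∀ k, List (StackAlphabet Γ₁ B Γ₂ k)
  | .inl k => S k
  | .inr (.inl _) => l
  | .inr (.inr k) => T k

theorem contents_nil :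
    contents (Γ₁ := Γ₁) (B := B) (Γ₂ := Γ₂) (fun _ => []) [] (fun _ => []) = fun _ => [] := by
  funext k
  rcases k with k | k | k <;> rfl

/-- Statements of the first machine; instead of halting, it starts to hand over. -/
def liftFst : TM2.Stmt Γ₁ Λ₁ σ₁ →
    TM2.Stmt (StackAlphabet Γ₁ B Γ₂) (Label Λ₁ B Λ₂) (State σ₁ σ₂ B)
  | .push k f q => .push (.inl k) (fun v => f v.1) (liftFst q)
  | .peek k f q => .peek (.inl k) (fun v s => (f v.1 s, v.2)) (liftFst q)
  | .pop k f q => .pop (.inl k) (fun v s => (f v.1 s, v.2)) (liftFst q)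
  | .load f q => .load (fun v => (f v.1, v.2)) (liftFst q)
  | .branch f q₁ q₂ => .branch (fun v => f v.1) (liftFst q₁) (liftFst q₂)
  | .goto f => .goto fun v => .inl (f v.1)
  | .halt => .goto fun _ => .inr (.inl (.inl none))

/-- Statements of the second machine. -/
def liftSnd : TM2.Stmt Γ₂ Λ₂ σ₂ →
    TM2.Stmt (StackAlphabet Γ₁ B Γ₂) (Label Λ₁ B Λ₂) (State σ₁ σ₂ B)
  | .push k f q => .push (.inr (.inr k)) (fun v => f v.2.1) (liftSnd q)
  | .peek k f q => .peek (.inr (.inr k)) (fun v s => (v.1, f v.2.1 s, v.2.2)) (liftSnd q)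
  | .pop k f q => .pop (.inr (.inr k)) (fun v s => (v.1, f v.2.1 s, v.2.2)) (liftSnd q)
  | .load f q => .load (fun v => (v.1, f v.2.1, v.2.2)) (liftSnd q)
  | .branch f q₁ q₂ => .branch (fun v => f v.2.1) (liftSnd q₁) (liftSnd q₂)
  | .goto f => .goto fun v => .inr (.inr (f v.2.1))
  | .halt => .halt

/-- The program of the composite machine, which hands over the word on stack `k₁` of the first
machine to stack `k₀` of the second one, where it enters at `main`. As popping reverses a word, the
word is handed over by way of the intermediate stack. -/
def program (M₁ : Λ₁ → TM2.Stmt Γ₁ Λ₁ σ₁) (M₂ : Λ₂ → TM2.Stmt Γ₂ Λ₂ σ₂) (k₁ : K₁) (k₀ : K₂)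
    (d : Γ₁ k₁ → B) (e : B → Γ₂ k₀) (main : Λ₂) :
    Label Λ₁ B Λ₂ → TM2.Stmt (StackAlphabet Γ₁ B Γ₂) (Label Λ₁ B Λ₂) (State σ₁ σ₂ B)
  | .inl l => liftFst (M₁ l)
  | .inr (.inl (.inl none)) =>
    .pop (.inl k₁) (fun v (s : Option (Γ₁ k₁)) => (v.1, v.2.1, s.map d)) <|
      .goto fun v => if v.2.2.isSome then .inr (.inl (.inl v.2.2)) else .inr (.inl (.inr none))
  | .inr (.inl (.inl (some b))) =>
    .push (.inr (.inl ())) (fun _ => b) <| .load (fun v => (v.1, v.2.1, none)) <|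
      .goto fun _ => .inr (.inl (.inl none))
  | .inr (.inl (.inr none)) =>
    .pop (.inr (.inl ())) (fun v (s : Option B) => (v.1, v.2.1, s)) <|
      .goto fun v => if v.2.2.isSome then .inr (.inl (.inr v.2.2)) else .inr (.inr main)
  | .inr (.inl (.inr (some b))) =>
    .push (.inr (.inr k₀)) (fun _ => e b) <| .load (fun v => (v.1, v.2.1, none)) <|
      .goto fun _ => .inr (.inl (.inr none))
  | .inr (.inr l) => liftSnd (M₂ l)

section

variable [DecidableEq K₁] [DecidableEq K₂]

@[simp] theorem update_contents_fst (S : ∀ k, List (Γ₁ k)) (l : List B) (T : ∀ k, List (Γ₂ k))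
    (k : K₁) (x : List (Γ₁ k)) :
    update (contents S l T) (.inl k) x = contents (update S k x) l T := by
  funext k'
  rcases k' with k' | k' | k'
  · rcases eq_or_ne k' k with rfl | h
    · simp [contents]
    · rw [update_of_ne (Sum.inl_injective.ne h)]; simp [contents, h]
  · rfl
  · rfl

@[simp] theorem update_contents_mid (S : ∀ k, List (Γ₁ k)) (l : List B) (T : ∀ k, List (Γ₂ k))
    (x : List B) :
    update (contents S l T) (.inr (.inl ())) x = contents S x T := by
  funext k'
  rcases k' with k' | k' | k' <;> rfl

@[simp] theorem update_contents_snd (S : ∀ k, List (Γ₁ k)) (l : List B) (T : ∀ k, List (Γ₂ k))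
    (k : K₂) (x : List (Γ₂ k)) :
    update (contents S l T) (.inr (.inr k)) x = contents S l (update T k x) := by
  funext k'
  rcases k' with k' | k' | k'
  · rfl
  · rfl
  · rcases eq_or_ne k' k with rfl | h
    · simp [contents]
    · rw [update_of_ne (Sum.inr_injective.ne (Sum.inr_injective.ne h))]; simp [contents, h]

/-- Configurations of the first machine as configurations of the composite one. -/
def cfgFst (w : σ₂) (c : TM2.Cfg Γ₁ Λ₁ σ₁) :
    TM2.Cfg (StackAlphabet Γ₁ B Γ₂) (Label Λ₁ B Λ₂) (State σ₁ σ₂ B) :=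
  ⟨some (match c.l with
    | some l => .inl l
    | none => .inr (.inl (.inl none))), (c.var, w, none), contents c.stk [] fun _ => []⟩

/-- Configurations of the second machine as configurations of the composite one. -/
def cfgSnd (v : σ₁) (c : TM2.Cfg Γ₂ Λ₂ σ₂) :
    TM2.Cfg (StackAlphabet Γ₁ B Γ₂) (Label Λ₁ B Λ₂) (State σ₁ σ₂ B) :=
  ⟨c.l.map fun l => .inr (.inr l), (v, c.var, none), contents (fun _ => []) [] c.stk⟩

theorem stepAux_liftFst (q : TM2.Stmt Γ₁ Λ₁ σ₁) (v : σ₁) (w : σ₂) (S : ∀ k, List (Γ₁ k)) :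
    TM2.stepAux (liftFst (Λ₂ := Λ₂) (Γ₂ := Γ₂) (B := B) q) (v, w, none)
      (contents S [] fun _ => []) = cfgFst w (TM2.stepAux q v S) := by
  induction q generalizing v S with
  | push _ _ _ ih =>
    simp only [liftFst, TM2.stepAux]
    rw [update_contents_fst]
    exact ih _ _
  | peek _ _ _ ih => exact ih _ _
  | pop _ _ _ ih =>
    simp only [liftFst, TM2.stepAux]
    rw [update_contents_fst]
    exact ih _ _
  | load _ _ ih => exact ih _ _
  | branch p _ _ ih₁ ih₂ =>
    simp only [liftFst, TM2.stepAux]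
    cases p v
    · exact ih₂ _ _
    · exact ih₁ _ _
  | goto | halt => rfl

theorem stepAux_liftSnd (q : TM2.Stmt Γ₂ Λ₂ σ₂) (v : σ₁) (w : σ₂) (T : ∀ k, List (Γ₂ k)) :
    TM2.stepAux (liftSnd (Λ₁ := Λ₁) (Γ₁ := Γ₁) (B := B) q) (v, w, none)
      (contents (fun _ => []) [] T) = cfgSnd v (TM2.stepAux q w T) := by
  induction q generalizing w T with
  | push _ _ _ ih =>
    simp only [liftSnd, TM2.stepAux]
    rw [update_contents_snd]
    exact ih _ _
  | peek _ _ _ ih => exact ih _ _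
  | pop _ _ _ ih =>
    simp only [liftSnd, TM2.stepAux]
    rw [update_contents_snd]
    exact ih _ _
  | load _ _ ih => exact ih _ _
  | branch p _ _ ih₁ ih₂ =>
    simp only [liftSnd, TM2.stepAux]
    cases p w
    · exact ih₂ _ _
    · exact ih₁ _ _
  | goto | halt => rfl

section Program

variable (M₁ : Λ₁ → TM2.Stmt Γ₁ Λ₁ σ₁) (M₂ : Λ₂ → TM2.Stmt Γ₂ Λ₂ σ₂) (k₁ : K₁) (k₀ : K₂)
  (d : Γ₁ k₁ → B) (e : B → Γ₂ k₀) (main : Λ₂)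

theorem step_cfgFst (w : σ₂) (c c' : TM2.Cfg Γ₁ Λ₁ σ₁) (h : TM2.step M₁ c = some c') :
    TM2.step (program M₁ M₂ k₁ k₀ d e main) (cfgFst w c) = some (cfgFst w c') := by
  obtain ⟨_ | l, v, S⟩ := c <;> cases h
  exact congrArg some (stepAux_liftFst _ _ _ _)

theorem step_cfgSnd (v : σ₁) (c c' : TM2.Cfg Γ₂ Λ₂ σ₂) (h : TM2.step M₂ c = some c') :
    TM2.step (program M₁ M₂ k₁ k₀ d e main) (cfgSnd v c) = some (cfgSnd v c') := by
  obtain ⟨_ | l, w, T⟩ := c <;> cases h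
  exact congrArg some (stepAux_liftSnd _ _ _ _)

variable (v : σ₁) (w : σ₂)

theorem runsIn_unload (s : List (Γ₁ k₁)) :
    RunsIn (TM2.step (program M₁ M₂ k₁ k₀ d e main)) (2 * s.length + 1)
      (cfgFst w ⟨none, v, update (fun _ => []) k₁ s⟩)
      ⟨some (.inr (.inl (.inr none))), (v, w, none),
        contents (fun _ => []) (s.map d).reverse fun _ => []⟩ := by
  let cfg (s : List (Γ₁ k₁)) (l : List B) :
      TM2.Cfg (StackAlphabet Γ₁ B Γ₂) (Label Λ₁ B Λ₂) (State σ₁ σ₂ B) :=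
    ⟨some (.inr (.inl (.inl none))), (v, w, none),
      contents (update (fun _ => []) k₁ s) l fun _ => []⟩
  rw [← List.append_nil (s.map d).reverse]
  refine (RunsIn.transfer cfg d 2 (fun a s l => ?_) s []).trans (.single ?_)
  · refine .head (b := ⟨some (.inr (.inl (.inl (some (d a))))), (v, w, some (d a)),
      contents (update (fun _ => []) k₁ s) l fun _ => []⟩) ?_ (.single ?_)
    all_goals simp [cfg, TM2.step, program, TM2.stepAux, contents]
  · simp [cfg, TM2.step, program, TM2.stepAux, contents]

theorem runsIn_load (l : List B) :
    RunsIn (TM2.step (program M₁ M₂ k₁ k₀ d e main)) (2 * l.length + 1)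
      ⟨some (.inr (.inl (.inr none))), (v, w, none), contents (fun _ => []) l fun _ => []⟩
      (cfgSnd v ⟨some main, w, update (fun _ => []) k₀ (l.map e).reverse⟩) := by
  let cfg (l : List B) (s : List (Γ₂ k₀)) :
      TM2.Cfg (StackAlphabet Γ₁ B Γ₂) (Label Λ₁ B Λ₂) (State σ₁ σ₂ B) :=
    ⟨some (.inr (.inl (.inr none))), (v, w, none),
      contents (fun _ => []) l (update (fun _ => []) k₀ s)⟩
  have start : update (fun _ => []) k₀ [] = fun k => ([] : List (Γ₂ k)) := update_eq_self _ _
  rw [← List.append_nil (l.map e).reverse, ← start]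
  refine (RunsIn.transfer cfg e 2 (fun b l s => ?_) l []).trans (.single ?_)
  · refine .head (b := ⟨some (.inr (.inl (.inr (some b)))), (v, w, some b),
      contents (fun _ => []) l (update (fun _ => []) k₀ s)⟩) ?_ (.single ?_)
    all_goals simp [cfg, TM2.step, program, TM2.stepAux, contents]
  · simp [cfg, TM2.step, program, TM2.stepAux, contents, cfgSnd]

end Program

end

/-- The composite of two machines, where `d` and `e` translate the letters that the first one
outputs into letters that the second one reads. -/
def machine (tm₁ tm₂ : FinTM2) {B : Type} [Fintype B] (d : tm₁.Γ tm₁.k₁ → B)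
    (e : B → tm₂.Γ tm₂.k₀) : FinTM2 :=
  letI := tm₁.kFin
  letI := tm₂.kFin
  letI := tm₁.ΛFin
  letI := tm₂.ΛFin
  letI := tm₁.σFin
  letI := tm₂.σFin
  { K := tm₁.K ⊕ (Unit ⊕ tm₂.K)
    k₀ := .inl tm₁.k₀
    k₁ := .inr (.inr tm₂.k₁)
    Γ := StackAlphabet tm₁.Γ B tm₂.Γ
    Λ := Label tm₁.Λ B tm₂.Λ
    main := .inl tm₁.main
    σ := State tm₁.σ tm₂.σ B
    initialState := (tm₁.initialState, tm₂.initialState, none)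
    Γk₀Fin := tm₁.Γk₀Fin
    m := program tm₁.m tm₂.m tm₁.k₁ tm₂.k₀ d e tm₂.main }

theorem outputs_machine {tm₁ tm₂ : FinTM2} {B : Type} [Fintype B] {d : tm₁.Γ tm₁.k₁ → B}
    {e : B → tm₂.Γ tm₂.k₀} {t₁ t₂ : ℕ} {s₁ : List (tm₁.Γ tm₁.k₀)} {w₁ : List (tm₁.Γ tm₁.k₁)}
    {w₂ : List (tm₂.Γ tm₂.k₁)} (h₁ : Outputs tm₁ t₁ s₁ w₁)
    (h₂ : Outputs tm₂ t₂ ((w₁.map d).map e) w₂) :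
    Outputs (machine tm₁ tm₂ d e) (t₁ + ((2 * w₁.length + 1) + ((2 * w₁.length + 1) + t₂)))
      s₁ w₂ := by
  have compute₁ := h₁.map (cfgFst tm₂.initialState)
    (step_cfgFst tm₁.m tm₂.m tm₁.k₁ tm₂.k₀ d e tm₂.main _)
  have unload := runsIn_unload tm₁.m tm₂.m tm₁.k₁ tm₂.k₀ d e tm₂.main tm₁.initialState
    tm₂.initialState w₁
  have load := runsIn_load tm₁.m tm₂.m tm₁.k₁ tm₂.k₀ d e tm₂.main tm₁.initialState
    tm₂.initialState (w₁.map d).reverse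
  have compute₂ := h₂.map (cfgSnd tm₁.initialState)
    (step_cfgSnd tm₁.m tm₂.m tm₁.k₁ tm₂.k₀ d e tm₂.main _)
  rw [List.map_reverse, List.reverse_reverse, List.length_reverse, List.length_map] at load
  have run := compute₁.trans (unload.trans (load.trans compute₂))
  unfold cfgFst cfgSnd at run
  rw [← update_contents_fst, ← update_contents_snd, contents_nil] at run
  exact run

end Comp

theorem eval_mono_nat (p : Polynomial ℕ) : Monotone fun n => p.eval n := fun m n h => by
  simp only [Polynomial.eval_eq_sum]
  exact Finset.sum_le_sum fun i _ => Nat.mul_le_mul_left _ (Nat.pow_le_pow_left h i)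

theorem PolyTime.comp {α β γ αΓ βΓ γΓ : Type} {ea : α → List αΓ} {eb : β → List βΓ}
    {ec : γ → List γΓ} {f : α → β} {g : β → γ} (hg : PolyTime eb ec g) (hf : PolyTime ea eb f) :
    PolyTime ea ec (g ∘ f) := by
  obtain ⟨h₁⟩ := hf
  obtain ⟨h₂⟩ := hg
  obtain ⟨c, hc⟩ := exists_length_encode_le h₁
  let _ := h₂.tm.Γk₀Fin
  let _ : Fintype βΓ := .ofEquiv _ h₂.inputAlphabet
  let B : Polynomial ℕ := Polynomial.X + Polynomial.C c * h₁.time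
  refine .of_outputs (Comp.machine h₁.tm h₂.tm h₁.outputAlphabet h₂.inputAlphabet.symm)
    h₁.inputAlphabet h₂.outputAlphabet
    (h₁.time + ((2 * B + 1) + ((2 * B + 1) + h₂.time.comp B))) fun a => ?_
  have hB : (eb (f a)).length ≤ B.eval (ea a).length := by simpa [B] using hc a
  have outputs₂ := outputs_of_computable h₂ (f a)
  rw [← List.map_id (eb (f a)), ← h₁.outputAlphabet.self_comp_symm, ← List.map_map] at outputs₂
  refine (Comp.outputs_machine (outputs_of_computable h₁ a) outputs₂).mono ?_
  have := eval_mono_nat h₂.time hB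
  simp only [Polynomial.eval_add, Polynomial.eval_mul, Polynomial.eval_comp, Polynomial.eval_one,
    Polynomial.eval_ofNat, List.length_map] at this ⊢
  omega

/-! ### Transducers with a counter -/

section PushWord

variable {K : Type*} {Γ : K → Type*} {Λ σ : Type*} (k : K) [Inhabited (Γ k)]

/-- Push the first `n` letters of the word `f v`, the last one first. -/
def pushTake (f : σ → List (Γ k)) (q : TM2.Stmt Γ Λ σ) : ℕ → TM2.Stmt Γ Λ σ
  | 0 => q
  | n + 1 => .branch (fun v => decide (n < (f v).length))
      (.push k (fun v => (f v).getD n default) (pushTake f q n)) (pushTake f q n)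

/-- Push the word `f v`, so that its first letter gets on top of the stack. -/
def pushWord [Fintype σ] (f : σ → List (Γ k)) (q : TM2.Stmt Γ Λ σ) : TM2.Stmt Γ Λ σ :=
  pushTake k f q (Finset.univ.sup fun v => (f v).length)

theorem stepAux_pushTake [DecidableEq K] (f : σ → List (Γ k)) (q : TM2.Stmt Γ Λ σ) (n : ℕ) (v : σ)
    (S : ∀ k, List (Γ k)) :
    TM2.stepAux (pushTake k f q n) v S =
      TM2.stepAux q v (update S k ((f v).take n ++ S k)) := by
  induction n generalizing S with
  | zero => simp [pushTake]
  | succ n ih =>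
    by_cases h : n < (f v).length
    · simp only [pushTake, TM2.stepAux, h, decide_true, cond_true, ih, update_self, update_idem]
      rw [List.take_add_one (i := n), List.getD_eq_getElem _ _ h, List.getElem?_eq_getElem h,
        List.append_assoc]
      rfl
    · simp only [pushTake, TM2.stepAux, h, decide_false, cond_false, ih]
      rw [List.take_of_length_le (by omega), List.take_of_length_le (by omega)]

theorem stepAux_pushWord [DecidableEq K] [Fintype σ] (f : σ → List (Γ k)) (q : TM2.Stmt Γ Λ σ)
    (v : σ) (S : ∀ k, List (Γ k)) :
    TM2.stepAux (pushWord k f q) v S = TM2.stepAux q v (update S k (f v ++ S k)) := by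
  rw [pushWord, stepAux_pushTake, List.take_of_length_le]
  exact Finset.le_sup (f := fun v => (f v).length) (Finset.mem_univ v)

end PushWord

/-- The operations on a counter. -/
inductive CounterOp
  | keep
  | inc
  | dec
  | reset
  deriving DecidableEq

instance : Fintype CounterOp :=
  ⟨{.keep, .inc, .dec, .reset}, fun x => by cases x <;> simp⟩

/-- The effect of an operation on a counter. -/
def CounterOp.app : CounterOp → ℕ → ℕ
  | keep, c => c
  | inc, c => c + 1
  | dec, c => c - 1
  | reset, _ => 0

theorem CounterOp.app_le (op : CounterOp) (c : ℕ) : op.app c ≤ c + 1 := by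
  cases op <;> simp only [CounterOp.app] <;> omega

/-- A finite-state transducer with a counter that can be tested for zero. The flag handed to
`next`, `op` and `out` is whether the counter is positive. -/
structure CounterTransducer (Q α β : Type) where
  /-- the initial state -/
  init : Q
  /-- the next state -/
  next : Q → Bool → α → Q
  /-- the operation on the counter -/
  op : Q → Bool → α → CounterOp
  /-- the word that is written -/
  out : Q → Bool → α → List β
  /-- the word that is written at the end -/
  fin : Q → List β

namespace CounterTransducer

variable {Q α β : Type} (T : CounterTransducer Q α β)

/-- The word that is written from state `q` and value `c` of the counter on. -/
def run : Q → ℕ → List α → List β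
  | q, _, [] => T.fin q
  | q, c, a :: l =>
    T.out q (decide (0 < c)) a ++
      run (T.next q (decide (0 < c)) a) ((T.op q (decide (0 < c)) a).app c) l

/-- The stacks of the machine that implements a transducer. -/
inductive Stack
  | inp
  | ctr
  | out
  deriving DecidableEq

instance : Fintype Stack :=
  ⟨{.inp, .ctr, .out}, fun x => by cases x <;> simp⟩

/-- The labels of the machine that implements a transducer: `drain` empties the counter, and then
halts if its argument is `true`. -/
inductive Label
  | read
  | act (o : CounterOp)
  | drain (done : Bool)
  deriving Fintype

/-- The stack alphabets of the machine: the counter is kept in unary. -/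
abbrev StackAlphabet (α β : Type) : Stack → Type
  | .inp => α
  | .ctr => Unit
  | .out => β

/-- The stacks of the machine. -/
def contents (i : List α) (c : ℕ) (o : List β) : ∀ k, List (StackAlphabet α β k)
  | .inp => i
  | .ctr => List.replicate c ()
  | .out => o

section Contents

variable (i x : List α) (c d : ℕ) (o y : List β)

@[simp] theorem contents_inp : contents i c o .inp = i := rfl

@[simp] theorem contents_ctr : contents i c o .ctr = List.replicate c () := rfl

@[simp] theorem contents_out : contents i c o .out = o := rfl

@[simp] theorem update_inp : update (contents i c o) .inp x = contents x c o := by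
  funext k; cases k <;> rfl

theorem update_ctr :
    update (contents i c o) .ctr (List.replicate d ()) = contents i d o := by
  funext k; cases k <;> rfl

@[simp] theorem update_out : update (contents i c o) .out y = contents i c y := by
  funext k; cases k <;> rfl

theorem update_nil_inp :
    update (fun k => ([] : List (StackAlphabet α β k))) .inp x = contents x 0 [] := by
  funext k; cases k <;> rfl

theorem update_nil_out :
    update (fun k => ([] : List (StackAlphabet α β k))) .out y = contents [] 0 y := by
  funext k; cases k <;> rfl

end Contents

/-- The internal states of the machine: state of the transducer, letter read, and whether the
counter was positive when it was last looked at. -/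
abbrev State (Q α : Type) := Q × Option α × Bool

/-- The internal state in which the next letter is read. -/
def State.next (v : State Q α) : State Q α := (v.2.1.elim v.1 (T.next v.1 v.2.2), none, false)

/-- The program of the machine. -/
def program [Fintype Q] [Fintype α] [Inhabited β] :
    Label → TM2.Stmt (StackAlphabet α β) Label (State Q α)
  | .read => .peek .ctr (fun v s => (v.1, none, s.isSome)) <|
      .pop .inp (fun v s => (v.1, s, v.2.2)) <|
      .branch (fun v => v.2.1.isNone)
        (pushWord .out (fun v => (T.fin v.1).reverse) <|
          .load (fun _ => (T.init, none, false)) <| .goto fun _ => .drain true)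
        (pushWord .out (fun v => (v.2.1.elim [] (T.out v.1 v.2.2)).reverse) <|
          .goto fun v => .act (v.2.1.elim .keep (T.op v.1 v.2.2)))
  | .act .keep => .load (State.next T) <| .goto fun _ => .read
  | .act .inc => .push .ctr (fun _ => ()) <| .load (State.next T) <| .goto fun _ => .read
  | .act .dec => .pop .ctr (fun v _ => v) <| .load (State.next T) <| .goto fun _ => .read
  | .act .reset => .load (State.next T) <| .goto fun _ => .drain false
  | .drain done => .pop .ctr (fun v s => (v.1, v.2.1, s.isSome)) <|
      .branch (fun v => v.2.2) (.goto fun _ => .drain done)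
        (if done then .halt else .goto fun _ => .read)

section Program

variable [Fintype Q] [Fintype α] [Inhabited β]

theorem runsIn_drain (done : Bool) (i : List α) (c : ℕ) (o : List β) (v : State Q α) :
    RunsIn (TM2.step T.program) (c + 1) ⟨some (.drain done), v, contents i c o⟩
      ⟨if done then none else some .read, (v.1, v.2.1, false), contents i 0 o⟩ := by
  induction c generalizing v with
  | zero =>
    refine .single ?_
    cases done <;> simp [program]
  | succ c ih =>
    refine .head ?_ (ih (v.1, v.2.1, true))
    simpa [program, List.replicate_succ] using update_ctr i (c + 1) c o

theorem runsIn_act (op : CounterOp) (i : List α) (c : ℕ) (o : List β) (v : State Q α) :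
    RunsIn (TM2.step T.program) (c + 3 - op.app c) ⟨some (.act op), v, contents i c o⟩
      ⟨some .read, State.next T v, contents i (op.app c) o⟩ := by
  cases op with
  | keep =>
    refine RunsIn.mono (.single ?_) (by simp only [CounterOp.app]; omega)
    simp [program, CounterOp.app]
  | inc =>
    refine RunsIn.mono (.single ?_) (by simp only [CounterOp.app]; omega)
    simpa [program, CounterOp.app, List.replicate_succ] using update_ctr i c (c + 1) o
  | dec =>
    refine RunsIn.mono (.single ?_) (by simp only [CounterOp.app]; omega)
    simpa [program, CounterOp.app] using update_ctr i c (c - 1) o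
  | reset =>
    exact (RunsIn.head (f := TM2.step T.program) rfl
      (T.runsIn_drain false i c o (State.next T v))).mono (by simp [CounterOp.app])

theorem isSome_head?_replicate (c : ℕ) :
    (List.replicate c ()).head?.isSome = decide (0 < c) := by
  cases c <;> rfl

theorem step_read_nil (q : Q) (c : ℕ) (o : List β) :
    TM2.step T.program ⟨some .read, (q, none, false), contents [] c o⟩ =
      some ⟨some (.drain true), (T.init, none, false), contents [] c ((T.fin q).reverse ++ o)⟩ := by
  simp [program, stepAux_pushWord]

theorem step_read_cons (q : Q) (a : α) (l : List α) (c : ℕ) (o : List β) :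
    TM2.step T.program ⟨some .read, (q, none, false), contents (a :: l) c o⟩ =
      some ⟨some (.act (T.op q (decide (0 < c)) a)), (q, some a, decide (0 < c)),
        contents l c ((T.out q (decide (0 < c)) a).reverse ++ o)⟩ := by
  simp [program, stepAux_pushWord, isSome_head?_replicate]

theorem runsIn_read (l : List α) (q : Q) (c : ℕ) (o : List β) :
    RunsIn (TM2.step T.program) (4 * l.length + c + 2)
      ⟨some .read, (q, none, false), contents l c o⟩
      ⟨none, (T.init, none, false), contents [] 0 ((T.run q c l).reverse ++ o)⟩ := by
  induction l generalizing q c o with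
  | nil =>
    exact (RunsIn.head (T.step_read_nil q c o) (T.runsIn_drain true _ c _ _)).mono (by simp)
  | cons a l ih =>
    rw [run, List.reverse_append, List.append_assoc, List.length_cons]
    refine (RunsIn.head (T.step_read_cons q a l c o)
      ((T.runsIn_act _ _ _ _ _).trans (ih _ _ _))).mono ?_
    have := CounterOp.app_le (T.op q (decide (0 < c)) a) c
    omega

/-- The machine that implements a transducer. It writes the output from its last letter to its
first one. -/
def machine : FinTM2 where
  K := Stack
  k₀ := .inp
  k₁ := .out
  Γ := StackAlphabet α β
  Λ := Label
  main := .read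
  σ := State Q α
  initialState := (T.init, none, false)
  Γk₀Fin := inferInstanceAs (Fintype α)
  m := T.program

theorem outputs_machine (l : List α) :
    Outputs T.machine ((4 * Polynomial.X + 2 : Polynomial ℕ).eval l.length) l
      (T.run T.init 0 l).reverse := by
  have run := T.runsIn_read l T.init 0 []
  rw [← update_nil_inp, List.append_nil, ← update_nil_out] at run
  exact run.mono (by simp)

end Program

variable [Finite Q] [Finite α] [Nonempty β]

theorem polyTime_run_reverse : PolyTime id id fun l => (T.run T.init 0 l).reverse := by
  cases nonempty_fintype Q
  cases nonempty_fintype α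
  inhabit β
  exact .id_of_outputs T.machine _ T.outputs_machine

end CounterTransducer

/-- The transducer that copies its input. -/
def copyTransducer (α : Type) : CounterTransducer Unit α α where
  init := ()
  next _ _ _ := ()
  op _ _ _ := .keep
  out _ _ a := [a]
  fin _ := []

theorem copyTransducer_run {α : Type} (c : ℕ) (l : List α) : (copyTransducer α).run () c l = l := by
  induction l generalizing c with
  | nil => rfl
  | cons a l ih => exact congrArg (a :: ·) (ih _)

theorem polyTime_reverse {α : Type} [Finite α] [Nonempty α] :
    PolyTime id id (List.reverse : List α → List α) :=
  PolyTime.of_comp_encode (copyTransducer α).polyTime_run_reverse fun l =>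
    congrArg List.reverse (copyTransducer_run 0 l)

theorem CounterTransducer.polyTime_run {Q α β : Type} [Finite Q] [Finite α] [Finite β] [Nonempty β]
    (T : CounterTransducer Q α β) : PolyTime id id (T.run T.init 0) :=
  PolyTime.of_comp_encode (polyTime_reverse.comp T.polyTime_run_reverse) fun _ =>
    List.reverse_reverse _

/-! ### Listing the positions of a word -/

/-- The side on which a letter of a word lies, seen from a given position. -/
inductive Side
  | left
  | self
  | right
  deriving DecidableEq

instance : Fintype Side :=
  ⟨{.left, .self, .right}, fun x => by cases x <;> simp⟩

/-- A letter of a word in which a position has been chosen, as a finite-state machine sees it: with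
its side, and together with the letter at the chosen position and a tag. -/
structure Sight (α : Type) (n : ℕ) where
  /-- the letter itself -/
  letter : α
  /-- the side of the chosen position on which it lies -/
  side : Side
  /-- the letter at the chosen position -/
  chosen : α
  /-- the tag of the chosen position -/
  tag : Fin (n + 1)

instance {α : Type} {n : ℕ} [Finite α] : Finite (Sight α n) :=
  Finite.of_injective (fun x => (x.letter, x.side, x.chosen, x.tag)) fun x y h => by
    cases x; cases y; simpa using h

/-- The word `pre ++ letter :: post` in which the position of `letter` is chosen, with a tag. -/
structure Pick (α : Type) (n : ℕ) where
  /-- the letters before the position -/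
  pre : List α
  /-- the letter at the position -/
  letter : α
  /-- the tag -/
  tag : Fin (n + 1)
  /-- the letters after the position -/
  post : List α

/-- The word of a pick as a finite-state machine sees it. -/
def Pick.sights {α : Type} {n : ℕ} (p : Pick α n) : List (Sight α n) :=
  p.pre.map (⟨·, .left, p.letter, p.tag⟩) ++
    ⟨p.letter, .self, p.letter, p.tag⟩ :: p.post.map (⟨·, .right, p.letter, p.tag⟩)

/-- The word `u ++ v` with every chosen position in `v` and every tag, the last position first. -/
def picks {α : Type} (n : ℕ) : List α → List α → List (Pick α n)
  | _, [] => []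
  | u, a :: v => picks n (u ++ [a]) v ++
      (List.range (n + 1)).map fun i => ⟨u, a, Fin.ofNat (n + 1) i, v⟩

namespace PickMachine

variable {α : Type} {n : ℕ}

/-- The stacks of a machine that lists the positions of a word. -/
inductive Stack
  | inp
  | left
  | tmp
  | out
  deriving DecidableEq

instance : Fintype Stack :=
  ⟨{.inp, .left, .tmp, .out}, fun x => by cases x <;> simp⟩

/-- The labels of the machine. For every pick it empties the stacks `inp` and `left`, which hold the
letters on the two sides of the chosen one, by way of `tmp`, and then refills them. -/
inductive Label
  | next
  | rightDown
  | rightUp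
  | leftDown
  | leftUp
  | clear
  deriving DecidableEq

instance : Fintype Label :=
  ⟨{.next, .rightDown, .rightUp, .leftDown, .leftUp, .clear}, fun x => by cases x <;> simp⟩

/-- The stack alphabets of the machine. -/
abbrev StackAlphabet (α : Type) (n : ℕ) : Stack → Type
  | .inp => α
  | .left => α
  | .tmp => α
  | .out => Sight α n

/-- The stacks of the machine. -/
def contents (i l t : List α) (o : List (Sight α n)) : ∀ k, List (StackAlphabet α n k)
  | .inp => i
  | .left => l
  | .tmp => t
  | .out => o

section Contents

variable (i l t x : List α) (o y : List (Sight α n))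

@[simp] theorem contents_inp : contents i l t o .inp = i := rfl

@[simp] theorem contents_left : contents i l t o .left = l := rfl

@[simp] theorem contents_tmp : contents i l t o .tmp = t := rfl

@[simp] theorem contents_out : contents i l t o .out = o := rfl

@[simp] theorem update_inp : update (contents i l t o) .inp x = contents x l t o := by
  funext k; cases k <;> rfl

@[simp] theorem update_left : update (contents i l t o) .left x = contents i x t o := by
  funext k; cases k <;> rfl

@[simp] theorem update_tmp : update (contents i l t o) .tmp x = contents i l x o := by
  funext k; cases k <;> rfl

@[simp] theorem update_out : update (contents i l t o) .out y = contents i l t y := by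
  funext k; cases k <;> rfl

theorem update_nil_inp :
    update (fun k => ([] : List (StackAlphabet α n k))) .inp x = contents x [] [] [] := by
  funext k; cases k <;> rfl

theorem update_nil_out :
    update (fun k => ([] : List (StackAlphabet α n k))) .out y = contents [] [] [] y := by
  funext k; cases k <;> rfl

end Contents

/-- The internal states of the machine: the letter at the chosen position, the tag, and the letter
read. -/
abbrev State (α : Type) (n : ℕ) := Option α × Fin (n + 1) × Option α

/-- The program of the machine. -/
def program (α : Type) [Inhabited α] (n : ℕ) :
    Label → TM2.Stmt (StackAlphabet α n) Label (State α n)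
  | .next => .pop .inp (fun _ s => (s, Fin.ofNat (n + 1) n, none)) <|
      .goto fun v => if v.1.isSome then .rightDown else .clear
  | .rightDown => .pop .inp (fun v s => (v.1, v.2.1, s)) <|
      .branch (fun v => v.2.2.isSome)
        (.push .tmp (fun v => v.2.2.getD default) <| .goto fun _ => .rightDown)
        (.goto fun _ => .rightUp)
  | .rightUp => .pop .tmp (fun v s => (v.1, v.2.1, s)) <|
      .branch (fun v => v.2.2.isSome)
        (.push .inp (fun v => v.2.2.getD default) <|
          .push .out (fun v => ⟨v.2.2.getD default, .right, v.1.getD default, v.2.1⟩) <|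
          .goto fun _ => .rightUp)
        (.push .out (fun v => ⟨v.1.getD default, .self, v.1.getD default, v.2.1⟩) <|
          .goto fun _ => .leftDown)
  | .leftDown => .pop .left (fun v s => (v.1, v.2.1, s)) <|
      .branch (fun v => v.2.2.isSome)
        (.push .tmp (fun v => v.2.2.getD default) <|
          .push .out (fun v => ⟨v.2.2.getD default, .left, v.1.getD default, v.2.1⟩) <|
          .goto fun _ => .leftDown)
        (.goto fun _ => .leftUp)
  | .leftUp => .pop .tmp (fun v s => (v.1, v.2.1, s)) <|
      .branch (fun v => v.2.2.isSome)
        (.push .left (fun v => v.2.2.getD default) <| .goto fun _ => .leftUp)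
        (.branch (fun v => decide (v.2.1.val = 0))
          (.push .left (fun v => v.1.getD default) <| .goto fun _ => .next)
          (.load (fun v => (v.1, Fin.ofNat (n + 1) (v.2.1.val - 1), none)) <|
            .goto fun _ => .rightDown))
  | .clear => .pop .left (fun v s => (v.1, v.2.1, s)) <|
      .branch (fun v => v.2.2.isSome) (.goto fun _ => .clear)
        (.load (fun _ => (none, 0, none)) .halt)

section Program

variable [Inhabited α] (a : α) (j : Fin (n + 1)) (s : Option α)

theorem runsIn_clear (l : List α) (o : List (Sight α n)) (v : State α n) :
    RunsIn (TM2.step (program α n)) (l.length + 1) ⟨some .clear, v, contents [] l [] o⟩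
      ⟨none, (none, 0, none), contents [] [] [] o⟩ := by
  induction l generalizing v with
  | nil => exact .single (by simp [program])
  | cons b l ih => exact .head (by simp [program]) (ih (v.1, v.2.1, some b))

theorem runsIn_rightDown (i l t : List α) (o : List (Sight α n)) :
    RunsIn (TM2.step (program α n)) (i.length + 1)
      ⟨some .rightDown, (some a, j, s), contents i l t o⟩
      ⟨some .rightUp, (some a, j, none), contents [] l (i.reverse ++ t) o⟩ := by
  induction i generalizing t s with
  | nil => exact .single (by simp [program])
  | cons b i ih =>
    simpa using RunsIn.head (a := ⟨some .rightDown, (some a, j, s), contents (b :: i) l t o⟩)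
      (by simp [program]) (ih (some b) (b :: t))

theorem runsIn_rightUp (i l t : List α) (o : List (Sight α n)) :
    RunsIn (TM2.step (program α n)) (t.length + 1)
      ⟨some .rightUp, (some a, j, s), contents i l t o⟩
      ⟨some .leftDown, (some a, j, none), contents (t.reverse ++ i) l []
        (⟨a, .self, a, j⟩ :: (t.reverse.map (⟨·, .right, a, j⟩) ++ o))⟩ := by
  induction t generalizing i o s with
  | nil => exact .single (by simp [program])
  | cons b t ih =>
    simpa using RunsIn.head (a := ⟨some .rightUp, (some a, j, s), contents i l (b :: t) o⟩)
      (by simp [program]) (ih (some b) (b :: i) (⟨b, .right, a, j⟩ :: o))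

theorem runsIn_leftDown (i l t : List α) (o : List (Sight α n)) :
    RunsIn (TM2.step (program α n)) (l.length + 1)
      ⟨some .leftDown, (some a, j, s), contents i l t o⟩
      ⟨some .leftUp, (some a, j, none), contents i [] (l.reverse ++ t)
        (l.reverse.map (⟨·, .left, a, j⟩) ++ o)⟩ := by
  induction l generalizing t o s with
  | nil => exact .single (by simp [program])
  | cons b l ih =>
    simpa using RunsIn.head (a := ⟨some .leftDown, (some a, j, s), contents i (b :: l) t o⟩)
      (by simp [program]) (ih (some b) (b :: t) (⟨b, .left, a, j⟩ :: o))

theorem runsIn_leftUp (i l t : List α) (o : List (Sight α n)) :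
    RunsIn (TM2.step (program α n)) (t.length + 1)
      ⟨some .leftUp, (some a, j, s), contents i l t o⟩
      (if j.val = 0 then ⟨some .next, (some a, j, none), contents i (a :: (t.reverse ++ l)) [] o⟩
        else ⟨some .rightDown, (some a, Fin.ofNat (n + 1) (j.val - 1), none),
          contents i (t.reverse ++ l) [] o⟩) := by
  induction t generalizing l s with
  | nil =>
    refine .single ?_
    by_cases h : j = 0 <;> simp [program, h]
  | cons b t ih =>
    simpa using RunsIn.head (a := ⟨some .leftUp, (some a, j, s), contents i l (b :: t) o⟩)
      (by simp [program]) (ih (some b) (b :: l))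

theorem runsIn_sights (u v : List α) (o : List (Sight α n)) :
    RunsIn (TM2.step (program α n)) (2 * (u.length + v.length) + 4)
      ⟨some .rightDown, (some a, j, none), contents v u.reverse [] o⟩
      (if j.val = 0 then ⟨some .next, (some a, j, none),
          contents v (u ++ [a]).reverse [] (Pick.sights ⟨u, a, j, v⟩ ++ o)⟩
        else ⟨some .rightDown, (some a, Fin.ofNat (n + 1) (j.val - 1), none),
          contents v u.reverse [] (Pick.sights ⟨u, a, j, v⟩ ++ o)⟩) := by
  have run := (((runsIn_rightDown a j none v u.reverse [] o).trans
    (runsIn_rightUp a j none [] u.reverse _ o)).trans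
    (runsIn_leftDown a j none _ u.reverse [] _)).trans (runsIn_leftUp a j none _ [] _ _)
  simp only [List.append_nil, List.reverse_reverse] at run
  simp only [Pick.sights, List.append_assoc, List.cons_append, List.reverse_append,
    List.reverse_cons, List.reverse_nil, List.nil_append]
  refine run.mono ?_
  simp only [List.length_reverse]
  omega

theorem runsIn_tags (u v : List α) (o : List (Sight α n)) (i : ℕ) (hi : i ≤ n) :
    ∃ w, RunsIn (TM2.step (program α n)) ((i + 1) * (2 * (u.length + v.length) + 4))
      ⟨some .rightDown, (some a, Fin.ofNat (n + 1) i, none), contents v u.reverse [] o⟩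
      ⟨some .next, w, contents v (u ++ [a]).reverse []
        (((List.range (i + 1)).map fun i => ⟨u, a, Fin.ofNat (n + 1) i, v⟩).flatMap
          Pick.sights ++ o)⟩ := by
  induction i generalizing o with
  | zero => exact ⟨_, by simpa using runsIn_sights a (Fin.ofNat (n + 1) 0) u v o⟩
  | succ i ih =>
    have run := runsIn_sights a (Fin.ofNat (n + 1) (i + 1)) u v o
    have val_eq : (Fin.ofNat (n + 1) (i + 1)).val = i + 1 := Nat.mod_eq_of_lt (by omega)
    rw [if_neg (by omega), val_eq, Nat.add_sub_cancel] at run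
    obtain ⟨w, runs⟩ := ih (Pick.sights ⟨u, a, Fin.ofNat (n + 1) (i + 1), v⟩ ++ o) (by omega)
    refine ⟨w, ?_⟩
    rw [List.range_succ, List.map_append, List.flatMap_append, List.append_assoc,
      List.map_singleton, List.flatMap_singleton]
    exact (run.trans runs).mono (by ring_nf; omega)

theorem runsIn_next (v u : List α) (o : List (Sight α n)) (w : State α n) :
    RunsIn (TM2.step (program α n))
      (v.length * ((n + 1) * (2 * (u.length + v.length) + 4) + 1) + (u.length + v.length) + 2)
      ⟨some .next, w, contents v u.reverse [] o⟩
      ⟨none, (none, 0, none), contents [] [] [] ((picks n u v).flatMap Pick.sights ++ o)⟩ := by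
  induction v generalizing u o w with
  | nil =>
    exact (RunsIn.head (by simp [program])
      (runsIn_clear u.reverse o (none, Fin.ofNat (n + 1) n, none))).mono (by simp)
  | cons a v ih =>
    obtain ⟨w', run⟩ := runsIn_tags a u v o n le_rfl
    rw [picks, List.flatMap_append, List.append_assoc]
    refine (RunsIn.head (by simp [program]) (run.trans (ih (u ++ [a]) _ w'))).mono ?_
    have bound : (n + 1) * (2 * (u.length + v.length) + 4) ≤
        (n + 1) * (2 * (u.length + (v.length + 1)) + 4) := by gcongr; omega
    rw [List.length_append, List.length_singleton, List.length_cons, add_assoc u.length,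
      add_comm 1, Nat.add_one_mul v.length]
    omega

/-- The machine that lists the positions of a word. -/
def machine (α : Type) [Fintype α] [Inhabited α] (n : ℕ) : FinTM2 where
  K := Stack
  k₀ := .inp
  k₁ := .out
  Γ := StackAlphabet α n
  Λ := Label
  main := .next
  σ := State α n
  initialState := (none, 0, none)
  Γk₀Fin := inferInstanceAs (Fintype α)
  m := program α n

theorem outputs_machine [Fintype α] (l : List α) :
    Outputs (machine α n) ((Polynomial.X * (Polynomial.C (n + 1) * (2 * Polynomial.X + 4) + 1) +
        Polynomial.X + 2 : Polynomial ℕ).eval l.length) l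
      ((picks n [] l).flatMap Pick.sights) := by
  have run := runsIn_next (n := n) l [] [] (none, 0, none)
  rw [List.reverse_nil, ← update_nil_inp, List.append_nil, ← update_nil_out] at run
  exact run.mono (by simp)

end Program

end PickMachine

theorem polyTime_sights {α : Type} [Finite α] [Nonempty α] (n : ℕ) :
    PolyTime id id fun l : List α => (picks n [] l).flatMap Pick.sights := by
  cases nonempty_fintype α
  inhabit α
  exact .id_of_outputs (PickMachine.machine α n) _ fun l =>
    PickMachine.outputs_machine (α := α) l

end Machines

/-! ### Counting components -/

theorem card_le_numComponents {X : Type} [TopologicalSpace X] {S : Set X} {D : Type}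
    [TopologicalSpace D] [DiscreteTopology D] {g : S → D} (hg : Continuous g)
    (surj : Function.Surjective g) : ENat.card D ≤ numComponents S := by
  have lift_surj : Function.Surjective hg.connectedComponentsLift := fun d =>
    let ⟨x, hx⟩ := surj d
    ⟨x, hx⟩
  exact ENat.card_le_card_of_injective (Function.injective_surjInv lift_surj)

theorem one_le_numComponents_iff {X : Type} [TopologicalSpace X] {S : Set X} :
    1 ≤ numComponents S ↔ S.Nonempty := by
  rw [numComponents, ENat.one_le_card_iff_nonempty, ← Set.nonempty_coe_sort]
  exact ⟨fun _ => ConnectedComponents.surjective_coe.nonempty, fun h => h.map (↑)⟩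

/-! ### The two-sheet polynomial -/

section TwoSheet

variable {m : ℕ} (r : MvPolynomial (Fin m) ℤ)

theorem aeval_sheetPenalty (x : Option (Fin m) → ℝ) :
    MvPolynomial.aeval x (sheetPenalty r) =
      MvPolynomial.aeval (fun j => x (some j)) r ^ 2 + (x none ^ 2 - 1) ^ 2 := by
  simp [sheetPenalty, MvPolynomial.aeval_rename, Function.comp_def]

theorem aeval_sheetPenalty_nonneg (x : Option (Fin m) → ℝ) :
    0 ≤ MvPolynomial.aeval x (sheetPenalty r) := by
  rw [aeval_sheetPenalty]
  positivity

theorem aeval_sheetPenalty_eq_zero {x : Option (Fin m) → ℝ} :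
    MvPolynomial.aeval x (sheetPenalty r) = 0 ↔ x ∈ sheets r := by
  rw [aeval_sheetPenalty, add_eq_zero_iff_of_nonneg (sq_nonneg _) (sq_nonneg _), sq_eq_zero_iff,
    sq_eq_zero_iff, sub_eq_zero, sq_eq_one_iff]
  rfl

theorem aeval_twoSheetCopies (n : ℕ) (x : Fin n × Option (Fin m) → ℝ) :
    MvPolynomial.aeval x (twoSheetCopies n r) =
      1 - ∑ i, MvPolynomial.aeval (fun v => x (i, v)) (sheetPenalty r) := by
  simp [twoSheetCopies, MvPolynomial.aeval_rename, Function.comp_def]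

theorem one_le_one_sub_iff_of_nonneg {a : ℝ} (ha : 0 ≤ a) : 1 ≤ 1 - a ↔ a = 0 := by
  rw [le_sub_self_iff, ha.ge_iff_eq']

theorem superLevel_twoSheet : superLevel (twoSheet r) 1 = sheets r := by
  ext x
  rw [← aeval_sheetPenalty_eq_zero,
    ← one_le_one_sub_iff_of_nonneg (aeval_sheetPenalty_nonneg r x)]
  simp only [superLevel, twoSheet, Set.mem_ofPred_eq, map_sub, map_one]

theorem superLevel_twoSheetCopies (n : ℕ) :
    superLevel (twoSheetCopies n r) 1 = {x | ∀ i : Fin n, (fun v => x (i, v)) ∈ sheets r} := by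
  ext x
  have nonneg (i : Fin n) := aeval_sheetPenalty_nonneg r fun v => x (i, v)
  simp only [superLevel, Set.mem_ofPred_eq, aeval_twoSheetCopies,
    one_le_one_sub_iff_of_nonneg (Finset.sum_nonneg fun i _ => nonneg i),
    Finset.sum_eq_zero_iff_of_nonneg fun i _ => nonneg i, Finset.mem_univ, true_imp_iff,
    aeval_sheetPenalty_eq_zero]

theorem card_signs : ENat.card ({1, -1} : Set ℝ) = 2 :=
  Set.encard_pair (by norm_num)

theorem two_le_numComponents_sheets_iff :
    2 ≤ numComponents (sheets r) ↔ (realZeros r).Nonempty := by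
  refine ⟨fun h => ?_, fun ⟨y, hy⟩ => ?_⟩
  · obtain ⟨x, hx⟩ := one_le_numComponents_iff.1 (one_le_two.trans h)
    exact ⟨_, hx.1⟩
  · rw [← card_signs]
    refine card_le_numComponents (g := fun x => ⟨x.1 none, x.2.2⟩) ?_ fun s => ?_
    · exact ((continuous_apply none).comp continuous_subtype_val).subtype_mk _
    · exact ⟨⟨fun v => v.elim (s : ℝ) y, ⟨hy, s.2⟩⟩, rfl⟩

theorem two_pow_le_numComponents_copies (n : ℕ) (hr : (realZeros r).Nonempty) :
    ((2 ^ n : ℕ) : ℕ∞) ≤ numComponents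
      {x : Fin n × Option (Fin m) → ℝ | ∀ i : Fin n, (fun v => x (i, v)) ∈ sheets r} := by
  obtain ⟨y, hy⟩ := hr
  have card_eq : ENat.card (Fin n → ({1, -1} : Set ℝ)) = (2 ^ n : ℕ) := by
    rw [ENat.card_fun, card_signs, ENat.card_eq_coe_fintype_card, Fintype.card_fin,
      ENat.epow_natCast, Nat.cast_pow, Nat.cast_ofNat]
  rw [← card_eq]
  refine card_le_numComponents (g := fun x i => ⟨x.1 (i, none), (x.2 i).2⟩) ?_ fun s => ?_
  · exact continuous_pi fun i =>
      ((continuous_apply (i, none)).comp continuous_subtype_val).subtype_mk _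
  · exact ⟨⟨fun p => p.2.elim (s p.1 : ℝ) y, fun i => ⟨hy, (s i).2⟩⟩, rfl⟩

theorem le_numComponents_copies_iff {k n : ℕ} (hk : 1 ≤ k) (hn : n ≠ 0) (hkn : k ≤ 2 ^ n) :
    (k : ℕ∞) ≤ numComponents
      {x : Fin n × Option (Fin m) → ℝ | ∀ i : Fin n, (fun v => x (i, v)) ∈ sheets r} ↔
      (realZeros r).Nonempty := by
  refine ⟨fun h => ?_, fun h =>
    (Nat.cast_le.2 hkn).trans (two_pow_le_numComponents_copies r n h)⟩
  obtain ⟨x, hx⟩ := one_le_numComponents_iff.1 ((Nat.one_le_cast.2 hk).trans h)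
  exact ⟨_, (hx ⟨0, Nat.pos_of_ne_zero hn⟩).1⟩

end TwoSheet

section Encoding

open MvPolynomial

/-! ### Annotated words and local equations -/

/-- The letters of the word of a sentence, annotated by their role; `start` and `finish` enclose
the word. -/
inductive Role : Type
  | start
  | tick
  | dimSep
  | coefBit (b : Bool)
  | coefSep
  | minus
  | expBit (b : Bool)
  | expSep
  | term
  | endPoly
  | eqZero
  | nonneg
  | pos
  | not
  | and
  | or
  | finish
  deriving DecidableEq, Fintype

instance : Inhabited Role := ⟨.start⟩

/-- The annotated word of a coefficient. -/
def roleCoef (z : ℤ) : List Role :=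
  (if z < 0 then [Role.minus] else []) ++
    ((Computability.encodeNat z.natAbs).map Role.coefBit ++ [Role.coefSep])

/-- The annotated word of a list of exponents. -/
def roleExponents (es : List ℕ) : List Role :=
  es.flatMap fun e => (Computability.encodeNat e).map Role.expBit ++ [Role.expSep]

/-- The annotated word of a term. -/
def roleTerm {d : ℕ} (t : ℤ × (Fin d → ℕ)) : List Role :=
  Role.term :: (roleCoef t.1 ++ roleExponents (List.ofFn t.2))

/-- The annotated word of a polynomial. -/
def rolePoly {d : ℕ} (p : PolyCode d) : List Role :=
  p.flatMap roleTerm ++ [Role.endPoly]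

/-- The annotated word of a formula. -/
def roleFormula {n : ℕ} : QFFormula n → List Role
  | .eqZero p => Role.eqZero :: rolePoly p
  | .nonneg p => Role.nonneg :: rolePoly p
  | .pos p => Role.pos :: rolePoly p
  | .not φ => Role.not :: roleFormula φ
  | .and φ ψ => Role.and :: (roleFormula φ ++ roleFormula ψ)
  | .or φ ψ => Role.or :: (roleFormula φ ++ roleFormula ψ)

/-- The annotated word of a sentence. -/
def roleWord (s : ExistsSentence) : List Role :=
  Role.start :: (List.replicate s.n Role.tick ++
    Role.dimSep :: (roleFormula s.matrix ++ [Role.finish]))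

/-- The letters that begin an atomic formula. -/
def Role.isAtom : Role → Bool
  | .eqZero | .nonneg | .pos => true
  | _ => false

/-- The letters that begin a conjunction or a disjunction. -/
def Role.isBinary : Role → Bool
  | .and | .or => true
  | _ => false

/-- The letters that begin a formula. -/
def Role.isHead : Role → Bool
  | .eqZero | .nonneg | .pos | .not | .and | .or => true
  | _ => false

/-- The letters that end a term: the first letter of the next term or the end of the
polynomial. -/
def Role.endsTerm : Role → Bool
  | .term | .endPoly => true
  | _ => false

/-- The positions of a word that matter for a given position: itself, the next one, the beginning
of the second operand, and the variable to which an exponent belongs. -/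
inductive Kind
  | self
  | next
  | operand
  | base
  deriving DecidableEq

instance : Fintype Kind := ⟨{.self, .next, .operand, .base}, fun K => by cases K <;> simp⟩

/-- The real registers of a position. -/
abbrev Regs := Fin 3 → ℝ

/-- Polynomials in the registers of the positions that matter for a given position. -/
abbrev LocalPoly := MvPolynomial (Kind × Fin 3) ℤ

/-- The `n`-th register of the position of kind `K`, as a variable. -/
noncomputable abbrev reg (K : Kind) (n : Fin 3) : LocalPoly := X (K, n)

/-- The value of a local polynomial, given the registers of the positions that matter. -/
noncomputable def evalAt (env : Kind → Regs) : LocalPoly →ₐ[ℤ] ℝ := aeval fun v => env v.1 v.2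

@[simp]
theorem evalAt_reg (env : Kind → Regs) (K : Kind) (n : Fin 3) :
    evalAt env (reg K n) = env K n :=
  aeval_X _ _

theorem evalAt_monomial (env : Kind → Regs) (c : ℤ) (e : Kind × Fin 3 →₀ ℕ) :
    evalAt env (monomial e c) = c * ∏ K, ∏ n, env K n ^ e (K, n) := by
  rw [evalAt, aeval_monomial, Finsupp.prod_fintype _ _ fun _ => pow_zero _,
    Fintype.prod_prod_type]
  rfl

/-- The sum of the squares of some polynomials. -/
noncomputable def sumSq (ps : List LocalPoly) : LocalPoly := (ps.map (· ^ 2)).sum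

theorem evalAt_sumSq_cons (env : Kind → Regs) (p : LocalPoly) (ps : List LocalPoly) :
    evalAt env (sumSq (p :: ps)) = evalAt env p ^ 2 + evalAt env (sumSq ps) := by
  simp only [sumSq, List.map_cons, List.sum_cons, map_add, map_pow]

theorem evalAt_sumSq_nonneg (env : Kind → Regs) (ps : List LocalPoly) :
    0 ≤ evalAt env (sumSq ps) := by
  induction ps with
  | nil => simp [sumSq]
  | cons p ps ih => rw [evalAt_sumSq_cons]; positivity

theorem evalAt_sumSq_eq_zero (env : Kind → Regs) (ps : List LocalPoly) :
    evalAt env (sumSq ps) = 0 ↔ ∀ p ∈ ps, evalAt env p = 0 := by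
  induction ps with
  | nil => simp [sumSq]
  | cons p ps ih =>
    rw [evalAt_sumSq_cons, add_eq_zero_iff_of_nonneg (sq_nonneg _) (evalAt_sumSq_nonneg env ps),
      ih, List.forall_mem_cons, sq_eq_zero_iff]

/-- The polynomial that confines the first register to the numbers less than `k`. -/
noncomputable def levels (k : ℕ) : LocalPoly := ∏ j ∈ Finset.range k, (reg .self 0 - j)

theorem evalAt_levels_eq_zero (env : Kind → Regs) (k : ℕ) :
    evalAt env (levels k) = 0 ↔ ∃ j < k, env .self 0 = j := by
  simp only [levels, map_prod, map_sub, evalAt_reg, map_natCast, Finset.prod_eq_zero_iff,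
    Finset.mem_range, sub_eq_zero]

/-- The equations between the registers of a position and of the positions that matter for it.
Read from right to left, the registers at a letter of a polynomial are the sum of the complete
terms, the product of the complete factors of the current term, and the current factor. The first
register at a letter that begins a formula is the truth value of the formula; the second one is a
witness for an equation or an inequality. -/
noncomputable def equations : Role → List LocalPoly
  | .start | .tick | .finish => []
  | .dimSep => [reg .next 0 - 1]
  | .endPoly => [reg .self 0, reg .self 1 - 1, reg .self 2 - 1]
  | .expSep =>
    [reg .self 0 - reg .next 0, reg .self 1 - reg .next 1 * reg .next 2, reg .self 2 - 1]
  | .coefSep =>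
    [reg .self 0 - reg .next 0, reg .self 1 - reg .next 1 * reg .next 2, reg .self 2]
  | .expBit b =>
    [reg .self 0 - reg .next 0, reg .self 1 - reg .next 1,
      reg .self 2 - reg .next 2 ^ 2 * if b then reg .base 0 else 1]
  | .coefBit b =>
    [reg .self 0 - reg .next 0, reg .self 1 - reg .next 1,
      reg .self 2 - (2 * reg .next 2 + if b then 1 else 0)]
  | .minus =>
    [reg .self 0 - reg .next 0, reg .self 1 - reg .next 1, reg .self 2 + reg .next 2]
  | .term =>
    [reg .self 0 - (reg .next 0 + reg .next 1 * reg .next 2), reg .self 1 - 1, reg .self 2 - 1]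
  | .eqZero =>
    [reg .self 0 * reg .next 0, (1 - reg .self 0) * (reg .next 0 * reg .self 1 - 1)]
  | .nonneg =>
    [reg .self 0 * (reg .next 0 - reg .self 1 ^ 2),
      (1 - reg .self 0) * (reg .next 0 * reg .self 1 ^ 2 + 1)]
  | .pos =>
    [reg .self 0 * (reg .next 0 * reg .self 1 ^ 2 - 1),
      (1 - reg .self 0) * (reg .next 0 + reg .self 1 ^ 2)]
  | .not => [reg .self 0 - (1 - reg .next 0)]
  | .and => [reg .self 0 - reg .next 0 * reg .operand 0]
  | .or => [reg .self 0 - (reg .next 0 + reg .operand 0 - reg .next 0 * reg .operand 0)]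

/-- The contribution of a position to the polynomial. -/
noncomputable def summand (k : ℕ) : Role → LocalPoly
  | .start => 1 - levels k ^ 2
  | a => -sumSq (equations a)

/-- A bound on the number of monomials of a summand. -/
noncomputable def width (k : ℕ) : ℕ := Finset.univ.sup fun a => (summand k a).support.card

/-- The coefficient and the exponents of the monomials of a summand, padded by zeros so that all
summands have equally many. -/
noncomputable def monoAt (k : ℕ) (a : Role) (j : ℕ) : ℤ × (Kind × Fin 3 →₀ ℕ) :=
  ((summand k a).support.toList.map fun e => ((summand k a).coeff e, e)).getD j (0, 0)

theorem sum_map_range_getD {α M : Type*} [AddCommMonoid M] (f : α → M) {z : α} (hz : f z = 0)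
    {l : List α} {n : ℕ} (hn : l.length ≤ n) :
    ((List.range n).map fun j => f (l.getD j z)).sum = (l.map f).sum := by
  induction l generalizing n with
  | nil => simp [hz]
  | cons a l ih =>
    obtain ⟨n, rfl⟩ := Nat.exists_eq_succ_of_ne_zero (Nat.ne_zero_of_lt hn)
    rw [List.range_succ_eq_map, List.map_cons, List.map_map, List.sum_cons, List.map_cons,
      List.sum_cons, ← ih (Nat.le_of_succ_le_succ hn)]
    rfl

theorem sum_monomial_monoAt (k : ℕ) (a : Role) :
    ((List.range (width k + 1)).map fun j => monomial (monoAt k a j).2 (monoAt k a j).1).sum =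
      summand k a := by
  have hlen : ((summand k a).support.toList.map fun e =>
      ((summand k a).coeff e, e)).length ≤ width k + 1 := by
    rw [List.length_map, Finset.length_toList]
    exact (Finset.le_sup (f := fun a => (summand k a).support.card) (Finset.mem_univ a)).trans
      (Nat.le_succ _)
  unfold monoAt
  rw [sum_map_range_getD (fun t : ℤ × (Kind × Fin 3 →₀ ℕ) => monomial t.2 t.1)
    monomial_zero hlen, List.map_map, Function.comp_def]
  exact (Finset.sum_map_toList _ _).trans (support_sum_monomial_coeff _)

/-! ### Finding the positions that matter -/

/-- The stages of the search for the second operand: within the first operand, behind it, done. -/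
inductive Search
  | seek
  | ready
  | found
  deriving DecidableEq

instance : Fintype Search := ⟨{.seek, .ready, .found}, fun s => by cases s <;> simp⟩

/-- The state of the scan to the right of a position. -/
structure Scan where
  /-- the next letter is the first one -/
  first : Bool
  /-- the current term has not ended -/
  inTerm : Bool
  /-- the stage of the search for the second operand -/
  search : Search
  deriving Fintype

/-- The state at the beginning of the scan. -/
def Scan.init : Scan := ⟨true, true, .seek⟩

/-- The next state of the scan. The counter holds the number of operands that are still to come
within the first operand; the flag is whether it is positive. -/
def Scan.next (q : Scan) (pos : Bool) (b : Role) : Scan where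
  first := false
  inTerm := q.inTerm && !b.endsTerm
  search := match q.search with
    | .seek => if b.isAtom && !pos then .ready else .seek
    | .ready => if b.isHead then .found else .ready
    | .found => .found

/-- The operation of the scan on the counter. -/
def Scan.op (q : Scan) (b : Role) : CounterOp :=
  if q.search = .seek then if b.isBinary then .inc else if b.isAtom then .dec else .keep
  else .keep

/-- The kind of a letter, as found by the scan. -/
def Scan.kind (q : Scan) (b : Role) : Option Kind :=
  if q.first then some .next
  else if q.search = .ready ∧ b.isHead = true then some .operand else none

/-- Whether the letter ends an exponent of the current term. -/
def Scan.counts (q : Scan) (b : Role) : Bool := q.inTerm && decide (b = .expSep)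

/-- The kinds of the letters to the right of a position, and whether they end an exponent of the
current term. -/
def scan : Scan → ℕ → List Role → List (Option Kind × Bool)
  | _, _, [] => []
  | q, c, b :: l =>
    (q.kind b, q.counts b) :: scan (q.next (decide (0 < c)) b) ((q.op b).app c) l

/-- The kinds of the letters to the left of a position, read from right to left. The base of the
current factor is found by counting; the flag is whether it has been found. -/
def leftScan : Bool → ℕ → List Role → List (Option Kind)
  | _, _, [] => []
  | f, c, b :: l =>
    (if b = .tick ∧ c = 0 ∧ f = false then some .base else none) ::
      leftScan (f || (decide (b = .tick) && !decide (0 < c)))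
        (if b = .dimSep ∨ b = .tick then c - 1 else c) l

/-- The number of ends of exponents to the right of a position within the current term. -/
def expCount (v : List Role) : ℕ := (scan .init 0 v).countP Prod.snd

/-- The kinds of the letters of the word `u ++ a :: v`, seen from the position of `a`. -/
def kinds (u v : List Role) : List (Option Kind) :=
  (leftScan false (expCount v) u.reverse).reverse ++ some .self :: (scan .init 0 v).map Prod.fst

theorem length_scan (q : Scan) (c : ℕ) (l : List Role) : (scan q c l).length = l.length := by
  induction l generalizing q c with
  | nil => rfl
  | cons b l ih => rw [scan, List.length_cons, ih, List.length_cons]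

theorem length_leftScan (f : Bool) (c : ℕ) (l : List Role) :
    (leftScan f c l).length = l.length := by
  induction l generalizing f c with
  | nil => rfl
  | cons b l ih => rw [leftScan, List.length_cons, ih, List.length_cons]

theorem length_kinds (u v : List Role) (a : Role) :
    (kinds u v).length = (u ++ a :: v).length := by
  simp [kinds, length_scan, length_leftScan]

theorem Scan.kind_seek (f t : Bool) (b : Role) : Scan.kind ⟨f, t, .seek⟩ b ≠ some .operand := by
  cases f <;> simp [Scan.kind]

theorem eq_operand_or_next_of_mem_scan {q : Scan} {c : ℕ} {l : List Role} {K : Kind}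
    (h : some K ∈ (scan q c l).map Prod.fst) :
    K = .operand ∨ K = .next ∧ q.first = true := by
  induction l generalizing q c with
  | nil => simp [scan] at h
  | cons b l ih =>
    simp only [scan, List.map_cons, List.mem_cons] at h
    rcases h with h | h
    · unfold Scan.kind at h
      split_ifs at h with h₁ h₂
      · exact .inr ⟨Option.some.inj h, h₁⟩
      · exact .inl (Option.some.inj h)
    · rcases ih h with h | h
      · exact .inl h
      · simp [Scan.next] at h

theorem eq_base_of_mem_leftScan {f : Bool} {c : ℕ} {l : List Role} {K : Kind}
    (h : some K ∈ leftScan f c l) : K = .base := by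
  induction l generalizing f c with
  | nil => simp [leftScan] at h
  | cons b l ih =>
    simp only [leftScan, List.mem_cons] at h
    rcases h with h | h
    · split_ifs at h
      exact Option.some.inj h
    · exact ih h

/-- The product of the registers at the positions of kind `K`: those of the only position of that
kind, or `1` if there is none. -/
def envOf (ks : List (Option Kind)) (vs : List Regs) (K : Kind) : Regs := fun n =>
  (List.zipWith (fun k r => if k = some K then r n else 1) ks vs).prod

theorem envOf_append {ks ks' : List (Option Kind)} {vs vs' : List Regs} (K : Kind)
    (h : ks.length = vs.length) :
    envOf (ks ++ ks') (vs ++ vs') K = envOf ks vs K * envOf ks' vs' K := by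
  funext n
  simp [envOf, List.zipWith_append h]

theorem envOf_cons (k : Option Kind) (r : Regs) (ks : List (Option Kind)) (vs : List Regs)
    (K : Kind) : envOf (k :: ks) (r :: vs) K = (if k = some K then r else 1) * envOf ks vs K := by
  funext n
  by_cases h : k = some K <;> simp [envOf, h]

theorem envOf_reverse {ks : List (Option Kind)} {vs : List Regs} (K : Kind)
    (h : ks.length = vs.length) : envOf ks.reverse vs.reverse K = envOf ks vs K := by
  funext n
  rw [envOf, envOf, ← List.reverse_zipWith h, List.prod_reverse]

theorem envOf_eq_one {ks : List (Option Kind)} {K : Kind} (h : some K ∉ ks) (vs : List Regs) :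
    envOf ks vs K = 1 := by
  induction ks generalizing vs with
  | nil => rfl
  | cons k ks ih =>
    rw [List.mem_cons, not_or] at h
    cases vs with
    | nil => rfl
    | cons r vs => rw [envOf_cons, ih h.2, if_neg (Ne.symm h.1), one_mul]

/-- A letter with the registers of its position. -/
abbrev Cell := Role × Regs

/-- The registers of the first letter. -/
def headRegs : List Cell → Regs
  | [] => 1
  | x :: _ => x.2

/-- The product of the registers at the operands that the scan finds from the state `q`. -/
def scanOperand (q : Scan) (c : ℕ) (l : List Cell) : Regs :=
  envOf ((scan q c (l.map Prod.fst)).map Prod.fst) (l.map Prod.snd) .operand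

/-- The registers at the beginning of the second operand. -/
def operandRegs (l : List Cell) : Regs := scanOperand .init 0 l

/-- The registers of the base, if `c` exponents end to the right of the position. -/
def baseRegs (l : List Cell) (c : ℕ) : Regs :=
  envOf (leftScan false c (l.map Prod.fst).reverse) (l.map Prod.snd).reverse .base

/-- The registers of the positions that matter for a letter with registers `r` that is followed by
`l`. The base is to the left of the letter and is given by `X`, as a function of the number of
exponents of the current term that end to the right of the letter. -/
def localEnv (X : ℕ → Regs) (r : Regs) (l : List Cell) : Kind → Regs
  | .self => r
  | .next => headRegs l
  | .operand => operandRegs l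
  | .base => X (expCount (l.map Prod.fst))

theorem envOf_scan_next (l : List Cell) :
    envOf ((scan .init 0 (l.map Prod.fst)).map Prod.fst) (l.map Prod.snd) .next = headRegs l := by
  cases l with
  | nil => rfl
  | cons x l =>
    refine (envOf_cons ..).trans ?_
    rw [envOf_eq_one fun h => ?_, mul_one]
    · rfl
    · rcases eq_operand_or_next_of_mem_scan h with h | h
      · cases h
      · exact Bool.false_ne_true h.2

theorem envOf_kinds (u l : List Cell) (r : Regs) :
    envOf (kinds (u.map Prod.fst) (l.map Prod.fst)) (u.map Prod.snd ++ r :: l.map Prod.snd) =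
      localEnv (baseRegs u) r l := by
  funext K
  have hlen : (leftScan false (expCount (l.map Prod.fst)) (u.map Prod.fst).reverse).length =
      (u.map Prod.snd).reverse.length := by simp [length_leftScan]
  have hrev := envOf_reverse K hlen
  rw [List.reverse_reverse] at hrev
  rw [kinds, envOf_append K (by simpa using hlen), envOf_cons, hrev]
  have hleft : K ≠ .base → envOf (leftScan false (expCount (l.map Prod.fst))
      (u.map Prod.fst).reverse) (u.map Prod.snd).reverse K = 1 := fun h =>
    envOf_eq_one (fun h' => h (eq_base_of_mem_leftScan h')) _
  have hright : K ≠ .operand → K ≠ .next →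
      envOf ((scan .init 0 (l.map Prod.fst)).map Prod.fst) (l.map Prod.snd) K = 1 :=
    fun h h' => envOf_eq_one
      (fun hK => (eq_operand_or_next_of_mem_scan hK).elim h fun hK' => h' hK'.1) _
  cases K with
  | self => rw [hleft (by decide), hright (by decide) (by decide)]; simp [localEnv]
  | next => rw [hleft (by decide), envOf_scan_next]; simp [localEnv]
  | operand => rw [hleft (by decide)]; simp [localEnv, operandRegs, scanOperand]
  | base => rw [hright (by decide) (by decide)]; simp [localEnv, baseRegs]

/-- The number of ends of exponents before the end of the current term. -/
def expEnds : List Role → ℕ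
  | [] => 0
  | b :: l => if b.endsTerm then 0 else (if b = .expSep then 1 else 0) + expEnds l

theorem countP_scan (q : Scan) (c : ℕ) (l : List Role) :
    (scan q c l).countP Prod.snd = if q.inTerm then expEnds l else 0 := by
  induction l generalizing q c with
  | nil => simp [scan, expEnds]
  | cons b l ih =>
    rw [scan, List.countP_cons, ih, expEnds]
    cases hq : q.inTerm
    · simp [Scan.next, Scan.counts, hq]
    · cases hb : b.endsTerm
      · simp [Scan.next, Scan.counts, hq, hb, add_comm]
      · have hsep : b ≠ .expSep := by rintro rfl; cases hb
        simp [Scan.next, Scan.counts, hq, hb, hsep]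

theorem expCount_eq_expEnds (l : List Role) : expCount l = expEnds l :=
  countP_scan .init 0 l

theorem scanOperand_cons (q : Scan) (c : ℕ) (x : Cell) (l : List Cell) :
    scanOperand q c (x :: l) = (if q.kind x.1 = some .operand then x.2 else 1) *
      scanOperand (q.next (decide (0 < c)) x.1) ((q.op x.1).app c) l :=
  envOf_cons ..

theorem scanOperand_inTerm (f t t' : Bool) (s : Search) (c : ℕ) (l : List Cell) :
    scanOperand ⟨f, t, s⟩ c l = scanOperand ⟨f, t', s⟩ c l := by
  induction l generalizing f t t' s c with
  | nil => rfl
  | cons x l ih =>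
    rw [scanOperand_cons, scanOperand_cons]
    exact congrArg _ (ih _ _ _ _ _)

theorem scanOperand_found (f t : Bool) (c : ℕ) (l : List Cell) :
    scanOperand ⟨f, t, .found⟩ c l = 1 := by
  induction l generalizing f t c with
  | nil => rfl
  | cons x l ih =>
    rw [scanOperand_cons, Scan.next, ih, mul_one, if_neg]
    cases f <;> simp [Scan.kind]

theorem scanOperand_ready {x : Cell} (hx : x.1.isHead = true) (t : Bool) (c : ℕ)
    (l : List Cell) : scanOperand ⟨false, t, .ready⟩ c (x :: l) = x.2 := by
  rw [scanOperand_cons]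
  simp [Scan.next, hx, scanOperand_found, Scan.kind]

theorem scanOperand_append_of_isHead_eq_false {l : List Cell}
    (hl : ∀ x ∈ l, x.1.isHead = false) (t : Bool) (s : Search) (c : ℕ) (l' : List Cell) :
    scanOperand ⟨false, t, s⟩ c (l ++ l') = scanOperand ⟨false, t, s⟩ c l' := by
  induction l with
  | nil => rfl
  | cons x l ih =>
    obtain ⟨hx, hl⟩ := List.forall_mem_cons.1 hl
    have hatom : x.1.isAtom = false := by
      revert hx; cases x.1 <;> simp [Role.isHead, Role.isAtom]
    have hbinary : x.1.isBinary = false := by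
      revert hx; cases x.1 <;> simp [Role.isHead, Role.isBinary]
    rw [← ih hl, List.cons_append, scanOperand_cons, scanOperand_inTerm _ t (t && !x.1.endsTerm)]
    cases s <;> simp [Scan.kind, Scan.next, Scan.op, hx, hatom, hbinary, CounterOp.app]

theorem isHead_roleTerm {d : ℕ} {t : ℤ × (Fin d → ℕ)} {b : Role} (hb : b ∈ roleTerm t) :
    b.isHead = false := by
  simp only [roleTerm, roleCoef, roleExponents, List.mem_cons, List.mem_append, List.mem_map,
    List.mem_flatMap, List.not_mem_nil, or_false] at hb
  rcases hb with rfl | (hb | ⟨_, _, rfl⟩ | rfl) | ⟨_, _, ⟨_, _, rfl⟩ | rfl⟩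
  · rfl
  · split_ifs at hb
    · rw [List.mem_singleton.1 hb]; rfl
    · cases hb
  all_goals rfl

theorem isHead_rolePoly {d : ℕ} {p : PolyCode d} {b : Role} (hb : b ∈ rolePoly p) :
    b.isHead = false := by
  simp only [rolePoly, List.mem_append, List.mem_flatMap, List.mem_singleton] at hb
  rcases hb with ⟨t, _, hb⟩ | rfl
  · exact isHead_roleTerm hb
  · rfl

theorem exists_roleFormula_eq_cons {n : ℕ} (φ : QFFormula n) :
    ∃ b l, roleFormula φ = b :: l ∧ b.isHead = true := by
  cases φ <;> exact ⟨_, _, rfl, rfl⟩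

theorem scanOperand_seek_cons (f t t' : Bool) (c : ℕ) (x : Cell) (l : List Cell) :
    scanOperand ⟨f, t, .seek⟩ c (x :: l) =
      scanOperand ⟨false, t', if x.1.isAtom = true ∧ c = 0 then .ready else .seek⟩
        (if x.1.isBinary then c + 1 else if x.1.isAtom then c - 1 else c) l := by
  rw [scanOperand_cons, if_neg (Scan.kind_seek _ _ _), one_mul,
    scanOperand_inTerm _ t' (t && !x.1.endsTerm)]
  have hop : (Scan.op ⟨f, t, .seek⟩ x.1).app c =
      if x.1.isBinary then c + 1 else if x.1.isAtom then c - 1 else c := by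
    simp only [Scan.op, if_true]
    split_ifs <;> rfl
  rw [hop]
  simp [Scan.next]

theorem scanOperand_atom {n : ℕ} {p : PolyCode n} {b : Role} (hb : b.isAtom = true)
    {l : List Cell} (hl : l.map Prod.fst = b :: rolePoly p) (f t t' : Bool) (c : ℕ)
    (l' : List Cell) : scanOperand ⟨f, t, .seek⟩ c (l ++ l') =
      scanOperand ⟨false, t', if c = 0 then .ready else .seek⟩ (c - 1) l' := by
  obtain ⟨x, l, rfl, rfl, hp⟩ := List.map_eq_cons_iff.1 hl
  have hbinary : x.1.isBinary = false := by
    revert hb; cases x.1 <;> simp [Role.isAtom, Role.isBinary]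
  have hbody : ∀ y ∈ l, y.1.isHead = false := fun y hy =>
    isHead_rolePoly (p := p) (by rw [← hp]; exact List.mem_map_of_mem hy)
  rw [List.cons_append, scanOperand_seek_cons _ _ t',
    scanOperand_append_of_isHead_eq_false hbody]
  simp [hb, hbinary]

theorem scanOperand_formula {n : ℕ} (φ : QFFormula n) {l : List Cell}
    (hl : l.map Prod.fst = roleFormula φ) (f t t' : Bool) (c : ℕ) (l' : List Cell) :
    scanOperand ⟨f, t, .seek⟩ c (l ++ l') =
      scanOperand ⟨false, t', if c = 0 then .ready else .seek⟩ (c - 1) l' := by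
  induction φ generalizing f t c l l' with
  | eqZero p | nonneg p | pos p => exact scanOperand_atom rfl hl f t t' c l'
  | not φ ih =>
    obtain ⟨x, l, rfl, hx, hl⟩ := List.map_eq_cons_iff.1 hl
    rw [List.cons_append, scanOperand_seek_cons _ _ t', hx, ← ih hl false t']
    simp [Role.isAtom, Role.isBinary]
  | and φ ψ ihφ ihψ | or φ ψ ihφ ihψ =>
    obtain ⟨x, l, rfl, hx, hl⟩ := List.map_eq_cons_iff.1 hl
    obtain ⟨l₁, l₂, rfl, h₁, h₂⟩ := List.map_eq_append_iff.1 hl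
    rw [List.cons_append, scanOperand_seek_cons _ _ t', hx, List.append_assoc,
      ← ihψ h₂ false t']
    exact (ihφ h₁ false t' (c + 1) (l₂ ++ l')).trans (by simp)

theorem operandRegs_formula {n : ℕ} {φ : QFFormula n} {l : List Cell}
    (hl : l.map Prod.fst = roleFormula φ) {x : Cell} (hx : x.1.isHead = true) (l' : List Cell) :
    operandRegs (l ++ x :: l') = x.2 :=
  (scanOperand_formula φ hl true true true 0 (x :: l')).trans (scanOperand_ready hx _ _ _)

/-! ### Solutions of the local equations -/

/-- `t` is the truth value of `P`: one if `P` holds, zero otherwise. -/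
def IsTruthValue (t : ℝ) (P : Prop) : Prop := P ∧ t = 1 ∨ ¬P ∧ t = 0

theorem exists_isTruthValue (P : Prop) : ∃ t, IsTruthValue t P :=
  (em P).elim (fun h => ⟨1, .inl ⟨h, rfl⟩⟩) fun h => ⟨0, .inr ⟨h, rfl⟩⟩

namespace IsTruthValue

variable {s t : ℝ} {P Q : Prop}

theorem eq_one_iff (h : IsTruthValue t P) : t = 1 ↔ P := by
  rcases h with ⟨hP, rfl⟩ | ⟨hP, rfl⟩ <;> simp [hP]

protected theorem not (h : IsTruthValue t P) : IsTruthValue (1 - t) (¬P) := by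
  rcases h with ⟨hP, rfl⟩ | ⟨hP, rfl⟩ <;> simp [IsTruthValue, hP]

protected theorem and (hP : IsTruthValue s P) (hQ : IsTruthValue t Q) :
    IsTruthValue (s * t) (P ∧ Q) := by
  rcases hP with ⟨hP, rfl⟩ | ⟨hP, rfl⟩ <;> rcases hQ with ⟨hQ, rfl⟩ | ⟨hQ, rfl⟩ <;>
    simp [IsTruthValue, hP, hQ]

protected theorem or (hP : IsTruthValue s P) (hQ : IsTruthValue t Q) :
    IsTruthValue (s + t - s * t) (P ∨ Q) := by
  rcases hP with ⟨hP, rfl⟩ | ⟨hP, rfl⟩ <;> rcases hQ with ⟨hQ, rfl⟩ | ⟨hQ, rfl⟩ <;>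
    simp [IsTruthValue, hP, hQ]

end IsTruthValue

theorem isTruthValue_eq_zero_iff {t v : ℝ} :
    IsTruthValue t (v = 0) ↔ ∃ w, t * v = 0 ∧ (1 - t) * (v * w - 1) = 0 := by
  constructor
  · rintro (⟨rfl, rfl⟩ | ⟨hv, rfl⟩)
    · exact ⟨0, by simp⟩
    · exact ⟨v⁻¹, by simp [hv]⟩
  · rintro ⟨w, h₁, h₂⟩
    by_cases hv : v = 0
    · exact .inl ⟨hv, by simp only [hv] at h₂; linarith⟩
    · exact .inr ⟨hv, (mul_eq_zero.1 h₁).resolve_right hv⟩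

theorem isTruthValue_nonneg_iff {t v : ℝ} :
    IsTruthValue t (0 ≤ v) ↔ ∃ w, t * (v - w ^ 2) = 0 ∧ (1 - t) * (v * w ^ 2 + 1) = 0 := by
  constructor
  · rintro (⟨hv, rfl⟩ | ⟨hv, rfl⟩)
    · exact ⟨√v, by simp [Real.sq_sqrt hv]⟩
    · refine ⟨√(-v⁻¹), by simp, ?_⟩
      have hinv : v⁻¹ ≤ 0 := inv_nonpos.2 (not_le.1 hv).le
      rw [Real.sq_sqrt (neg_nonneg.2 hinv), mul_neg, mul_inv_cancel₀ (not_le.1 hv).ne]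
      norm_num
  · rintro ⟨w, h₁, h₂⟩
    rcases mul_eq_zero.1 h₁ with rfl | hv
    · exact .inr ⟨fun hv => by nlinarith [mul_nonneg hv (sq_nonneg w)], rfl⟩
    · have hv' : v = w ^ 2 := sub_eq_zero.1 hv
      refine .inl ⟨hv' ▸ sq_nonneg w, ?_⟩
      rcases mul_eq_zero.1 h₂ with ht | h
      · linarith
      · rw [hv'] at h
        nlinarith [mul_self_nonneg (w ^ 2)]

theorem isTruthValue_pos_iff {t v : ℝ} :
    IsTruthValue t (0 < v) ↔ ∃ w, t * (v * w ^ 2 - 1) = 0 ∧ (1 - t) * (v + w ^ 2) = 0 := by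
  constructor
  · rintro (⟨hv, rfl⟩ | ⟨hv, rfl⟩)
    · exact ⟨√v⁻¹, by simp only [Real.sq_sqrt (inv_nonneg.2 hv.le)]; simp [hv.ne']⟩
    · exact ⟨√(-v), by simp [Real.sq_sqrt (neg_nonneg.2 (not_lt.1 hv))]⟩
  · rintro ⟨w, h₁, h₂⟩
    by_cases hv : 0 < v
    · have hpos : v + w ^ 2 ≠ 0 := by positivity
      exact .inl ⟨hv, by linarith [(mul_eq_zero.1 h₂).resolve_right hpos]⟩
    · have hneg : v * w ^ 2 - 1 ≠ 0 := by
        nlinarith [mul_nonneg (neg_nonneg.2 (not_lt.1 hv)) (sq_nonneg w)]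
      exact .inr ⟨hv, (mul_eq_zero.1 h₁).resolve_right hneg⟩

/-- The registers `r` of a letter `a` that is followed by `l` satisfy its equations. -/
def Solves (X : ℕ → Regs) (a : Role) (r : Regs) (l : List Cell) : Prop :=
  ∀ p ∈ equations a, evalAt (localEnv X r l) p = 0

section

variable {X : ℕ → Regs} {r : Regs} {l : List Cell}

theorem solves_of_equations_eq_nil {a : Role} (h : equations a = []) : Solves X a r l := by
  simp [Solves, h]

theorem solves_dimSep : Solves X .dimSep r l ↔ headRegs l 0 = 1 := by
  simp [Solves, equations, localEnv, sub_eq_zero]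

theorem solves_endPoly : Solves X .endPoly r l ↔ r = ![0, 1, 1] := by
  simp [Solves, equations, localEnv, sub_eq_zero, funext_iff, Fin.forall_fin_succ]

theorem solves_expSep : Solves X .expSep r l ↔
    r = ![headRegs l 0, headRegs l 1 * headRegs l 2, 1] := by
  simp [Solves, equations, localEnv, sub_eq_zero, funext_iff, Fin.forall_fin_succ]

theorem solves_expBit {b : Bool} : Solves X (.expBit b) r l ↔ r = ![headRegs l 0, headRegs l 1,
    headRegs l 2 ^ 2 * if b then X (expCount (l.map Prod.fst)) 0 else 1] := by
  cases b <;>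
    simp [Solves, equations, localEnv, sub_eq_zero, funext_iff, Fin.forall_fin_succ]

theorem solves_coefSep : Solves X .coefSep r l ↔
    r = ![headRegs l 0, headRegs l 1 * headRegs l 2, 0] := by
  simp [Solves, equations, localEnv, sub_eq_zero, funext_iff, Fin.forall_fin_succ]

theorem solves_coefBit {b : Bool} : Solves X (.coefBit b) r l ↔
    r = ![headRegs l 0, headRegs l 1, 2 * headRegs l 2 + b.toNat] := by
  cases b <;>
    simp [Solves, equations, localEnv, sub_eq_zero, funext_iff, Fin.forall_fin_succ, map_ofNat]

theorem solves_minus : Solves X .minus r l ↔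
    r = ![headRegs l 0, headRegs l 1, -headRegs l 2] := by
  simp [Solves, equations, localEnv, sub_eq_zero, funext_iff, Fin.forall_fin_succ,
    add_eq_zero_iff_eq_neg]

theorem solves_term : Solves X .term r l ↔
    r = ![headRegs l 0 + headRegs l 1 * headRegs l 2, 1, 1] := by
  simp [Solves, equations, localEnv, sub_eq_zero, funext_iff, Fin.forall_fin_succ]

theorem solves_eqZero : Solves X .eqZero r l ↔
    r 0 * headRegs l 0 = 0 ∧ (1 - r 0) * (headRegs l 0 * r 1 - 1) = 0 := by
  simp [Solves, equations, localEnv]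

theorem solves_nonneg : Solves X .nonneg r l ↔
    r 0 * (headRegs l 0 - r 1 ^ 2) = 0 ∧ (1 - r 0) * (headRegs l 0 * r 1 ^ 2 + 1) = 0 := by
  simp [Solves, equations, localEnv]

theorem solves_pos : Solves X .pos r l ↔
    r 0 * (headRegs l 0 * r 1 ^ 2 - 1) = 0 ∧ (1 - r 0) * (headRegs l 0 + r 1 ^ 2) = 0 := by
  simp [Solves, equations, localEnv]

theorem solves_not : Solves X .not r l ↔ r 0 = 1 - headRegs l 0 := by
  simp [Solves, equations, localEnv, sub_eq_zero]

theorem solves_and : Solves X .and r l ↔ r 0 = headRegs l 0 * operandRegs l 0 := by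
  simp [Solves, equations, localEnv, sub_eq_zero]

theorem solves_or : Solves X .or r l ↔
    r 0 = headRegs l 0 + operandRegs l 0 - headRegs l 0 * operandRegs l 0 := by
  simp [Solves, equations, localEnv, sub_eq_zero]

theorem exists_solves (X : ℕ → Regs) {a : Role} (ha : a ≠ .dimSep) (l : List Cell) :
    ∃ r, Solves X a r l := by
  cases a with
  | start | tick | finish => exact ⟨0, solves_of_equations_eq_nil rfl⟩
  | dimSep => exact absurd rfl ha
  | endPoly => exact ⟨_, solves_endPoly.2 rfl⟩
  | expSep => exact ⟨_, solves_expSep.2 rfl⟩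
  | expBit b => exact ⟨_, solves_expBit.2 rfl⟩
  | coefSep => exact ⟨_, solves_coefSep.2 rfl⟩
  | coefBit b => exact ⟨_, solves_coefBit.2 rfl⟩
  | minus => exact ⟨_, solves_minus.2 rfl⟩
  | term => exact ⟨_, solves_term.2 rfl⟩
  | eqZero =>
    obtain ⟨t, ht⟩ := exists_isTruthValue (headRegs l 0 = 0)
    obtain ⟨w, hw⟩ := isTruthValue_eq_zero_iff.1 ht
    exact ⟨![t, w, 0], solves_eqZero.2 hw⟩
  | nonneg =>
    obtain ⟨t, ht⟩ := exists_isTruthValue (0 ≤ headRegs l 0)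
    obtain ⟨w, hw⟩ := isTruthValue_nonneg_iff.1 ht
    exact ⟨![t, w, 0], solves_nonneg.2 hw⟩
  | pos =>
    obtain ⟨t, ht⟩ := exists_isTruthValue (0 < headRegs l 0)
    obtain ⟨w, hw⟩ := isTruthValue_pos_iff.1 ht
    exact ⟨![t, w, 0], solves_pos.2 hw⟩
  | not => exact ⟨fun _ => _, solves_not.2 rfl⟩
  | and => exact ⟨fun _ => _, solves_and.2 rfl⟩
  | or => exact ⟨fun _ => _, solves_or.2 rfl⟩

end

/-- The registers of all letters of a word satisfy their equations. -/
def SolvesAll (X : ℕ → Regs) : List Cell → Prop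
  | [] => True
  | x :: l => Solves X x.1 x.2 l ∧ SolvesAll X l

theorem exists_solvesAll (X : ℕ → Regs) {w : List Role} (hw : Role.dimSep ∉ w) :
    ∃ l : List Cell, l.map Prod.fst = w ∧ SolvesAll X l := by
  induction w with
  | nil => exact ⟨[], rfl, trivial⟩
  | cons a w ih =>
    rw [List.mem_cons, not_or] at hw
    obtain ⟨l, rfl, hl⟩ := ih hw.2
    obtain ⟨r, hr⟩ := exists_solves X (Ne.symm hw.1) l
    exact ⟨(a, r) :: l, rfl, hr, hl⟩

section

variable {X : ℕ → Regs} {l rest : List Cell}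

theorem SolvesAll.of_append (h : SolvesAll X (l ++ rest)) : SolvesAll X rest := by
  induction l with
  | nil => exact h
  | cons x l ih => exact ih h.2

theorem SolvesAll.exists_cons (h : SolvesAll X (l ++ rest)) {a : Role} {w : List Role}
    (hl : l.map Prod.fst = a :: w) : ∃ r l', l = (a, r) :: l' ∧ l'.map Prod.fst = w ∧
      Solves X a r (l' ++ rest) ∧ SolvesAll X (l' ++ rest) := by
  obtain ⟨⟨_, r⟩, l', rfl, rfl, hl'⟩ := List.map_eq_cons_iff.1 hl
  exact ⟨r, l', rfl, hl', h⟩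

theorem foldr_bit_encodePosNum (n : PosNum) :
    (Computability.encodePosNum n).foldr Nat.bit 0 = n := by
  induction n with
  | one => rfl
  | bit0 n ih | bit1 n ih =>
    simp [Computability.encodePosNum, ih, Nat.bit_val, two_mul]

theorem foldr_bit_encodeNat (n : ℕ) : (Computability.encodeNat n).foldr Nat.bit 0 = n := by
  suffices h : ∀ m : Num, (Computability.encodeNum m).foldr Nat.bit 0 = m by
    rw [Computability.encodeNat, h, Num.to_of_nat]
  rintro (_ | m)
  · rfl
  · exact foldr_bit_encodePosNum m

theorem headRegs_coefBits (bs : List Bool)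
    (hl : l.map Prod.fst = bs.map Role.coefBit ++ [Role.coefSep])
    (h : SolvesAll X (l ++ rest)) : headRegs (l ++ rest) =
      ![headRegs rest 0, headRegs rest 1 * headRegs rest 2, (bs.foldr Nat.bit 0 : ℕ)] := by
  induction bs generalizing l with
  | nil =>
    obtain ⟨r, l, rfl, hnil, hr, -⟩ := h.exists_cons hl
    obtain rfl := List.map_eq_nil_iff.1 hnil
    exact (solves_coefSep.1 hr).trans (by simp)
  | cons b bs ih =>
    obtain ⟨r, l, rfl, hl, hr, htail⟩ := h.exists_cons hl
    refine (solves_coefBit.1 hr).trans ?_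
    rw [ih hl htail]
    simp [Nat.bit_val]

theorem headRegs_roleCoef (z : ℤ) (hl : l.map Prod.fst = roleCoef z)
    (h : SolvesAll X (l ++ rest)) : headRegs (l ++ rest) =
      ![headRegs rest 0, headRegs rest 1 * headRegs rest 2, z] := by
  unfold roleCoef at hl
  split_ifs at hl with hz
  · obtain ⟨r, l, rfl, hl, hr, htail⟩ := h.exists_cons hl
    refine (solves_minus.1 hr).trans ?_
    rw [headRegs_coefBits _ hl htail, foldr_bit_encodeNat, Nat.cast_natAbs, abs_of_neg hz]
    simp
  · rw [headRegs_coefBits _ hl h, foldr_bit_encodeNat, Nat.cast_natAbs,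
      abs_of_nonneg (not_lt.1 hz)]

theorem expEnds_expBits (bs : List Bool) (w : List Role) :
    expEnds (bs.map Role.expBit ++ Role.expSep :: w) = expEnds w + 1 := by
  induction bs with
  | nil => simp [expEnds, Role.endsTerm, add_comm]
  | cons b bs ih => simpa [expEnds, Role.endsTerm] using ih

theorem roleExponents_cons (e : ℕ) (es : List ℕ) : roleExponents (e :: es) =
    ((Computability.encodeNat e).map Role.expBit ++ [Role.expSep]) ++ roleExponents es :=
  rfl

theorem expEnds_roleExponents (es : List ℕ) (w : List Role) :
    expEnds (roleExponents es ++ w) = es.length + expEnds w := by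
  induction es with
  | nil => simp [roleExponents]
  | cons e es ih =>
    rw [roleExponents_cons, List.append_assoc, List.append_assoc,
      List.singleton_append, expEnds_expBits, ih, List.length_cons]
    omega

theorem expEnds_rolePoly {d : ℕ} (p : PolyCode d) (w : List Role) :
    expEnds (rolePoly p ++ w) = 0 := by
  cases p <;> rfl

theorem headRegs_expBits (bs : List Bool)
    (hl : l.map Prod.fst = bs.map Role.expBit ++ [Role.expSep]) (h : SolvesAll X (l ++ rest)) :
    headRegs (l ++ rest) = ![headRegs rest 0, headRegs rest 1 * headRegs rest 2,
      X (expEnds (rest.map Prod.fst) + 1) 0 ^ bs.foldr Nat.bit 0] := by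
  induction bs generalizing l with
  | nil =>
    obtain ⟨r, l, rfl, hnil, hr, -⟩ := h.exists_cons hl
    obtain rfl := List.map_eq_nil_iff.1 hnil
    exact (solves_expSep.1 hr).trans (by simp)
  | cons b bs ih =>
    obtain ⟨r, l, rfl, hl, hr, htail⟩ := h.exists_cons hl
    have hcount : expCount ((l ++ rest).map Prod.fst) = expEnds (rest.map Prod.fst) + 1 := by
      rw [expCount_eq_expEnds, List.map_append, hl, List.append_eq, List.append_assoc,
        List.singleton_append, expEnds_expBits]
    refine (solves_expBit.1 hr).trans ?_
    rw [hcount, ih hl htail]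
    cases b <;> simp [Nat.bit_val, pow_succ, pow_mul']

/-- The power product with given exponents, where the base of an exponent is found from the
number of exponents up to the end of the list. -/
def powerProduct (X : ℕ → Regs) : List ℕ → ℝ
  | [] => 1
  | e :: es => X (es.length + 1) 0 ^ e * powerProduct X es

theorem headRegs_roleExponents (es : List ℕ) (hl : l.map Prod.fst = roleExponents es)
    (hrest : expEnds (rest.map Prod.fst) = 0) (h : SolvesAll X (l ++ rest)) :
    headRegs (l ++ rest) 0 = headRegs rest 0 ∧
      headRegs (l ++ rest) 1 * headRegs (l ++ rest) 2 =
        headRegs rest 1 * headRegs rest 2 * powerProduct X es := by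
  induction es generalizing l with
  | nil =>
    obtain rfl := List.map_eq_nil_iff.1 hl
    exact ⟨rfl, (mul_one _).symm⟩
  | cons e es ih =>
    rw [roleExponents_cons] at hl
    obtain ⟨l₁, l₂, rfl, h₁, h₂⟩ := List.map_eq_append_iff.1 hl
    rw [List.append_assoc] at h ⊢
    obtain ⟨hsum, hprod⟩ := ih h₂ h.of_append
    have hcount : expEnds ((l₂ ++ rest).map Prod.fst) = es.length := by
      rw [List.map_append, h₂, expEnds_roleExponents, hrest, add_zero]
    rw [headRegs_expBits _ h₁ h, hcount, foldr_bit_encodeNat]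
    refine ⟨hsum, ?_⟩
    simp only [Matrix.cons_val]
    rw [hprod, powerProduct]
    ring

/-- The values of the variables. -/
def baseValues (X : ℕ → Regs) (d : ℕ) (i : Fin d) : ℝ := X (d - i) 0

theorem powerProduct_ofFn (X : ℕ → Regs) {d : ℕ} (e : Fin d → ℕ) :
    powerProduct X (List.ofFn e) = ∏ i, baseValues X d i ^ e i := by
  induction d with
  | zero => rfl
  | succ d ih =>
    rw [List.ofFn_succ, powerProduct, ih, Fin.prod_univ_succ]
    simp [baseValues]

theorem aeval_toPoly {d : ℕ} (p : PolyCode d) (x : Fin d → ℝ) :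
    aeval x p.toPoly = (p.map fun t => (t.1 : ℝ) * ∏ i, x i ^ t.2 i).sum := by
  rw [PolyCode.toPoly, map_list_sum, List.map_map]
  refine congrArg List.sum (List.map_congr_left fun t _ => ?_)
  rw [Function.comp_apply, aeval_monomial, Finsupp.prod_fintype _ _ fun _ => pow_zero _]
  rfl

theorem headRegs_roleTerm {d : ℕ} (t : ℤ × (Fin d → ℕ)) (hl : l.map Prod.fst = roleTerm t)
    (hrest : expEnds (rest.map Prod.fst) = 0) (hone : headRegs rest 1 = 1)
    (hone' : headRegs rest 2 = 1) (h : SolvesAll X (l ++ rest)) : headRegs (l ++ rest) =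
      ![headRegs rest 0 + t.1 * ∏ i, baseValues X d i ^ t.2 i, 1, 1] := by
  obtain ⟨r, l, rfl, hl, hr, htail⟩ := h.exists_cons hl
  obtain ⟨l₁, l₂, rfl, h₁, h₂⟩ := List.map_eq_append_iff.1 hl
  refine (solves_term.1 hr).trans ?_
  rw [List.append_assoc] at htail ⊢
  obtain ⟨hsum, hprod⟩ := headRegs_roleExponents _ h₂ hrest htail.of_append
  rw [headRegs_roleCoef _ h₁ htail, hsum, hprod, hone, hone', powerProduct_ofFn, one_mul, one_mul]
  simp [mul_comm]

theorem headRegs_rolePoly {d : ℕ} (p : PolyCode d) (hl : l.map Prod.fst = rolePoly p)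
    (h : SolvesAll X (l ++ rest)) :
    headRegs (l ++ rest) = ![aeval (baseValues X d) p.toPoly, 1, 1] := by
  induction p generalizing l with
  | nil =>
    obtain ⟨r, l, rfl, -, hr, -⟩ := h.exists_cons hl
    rw [aeval_toPoly, List.map_nil, List.sum_nil]
    exact solves_endPoly.1 hr
  | cons t p ih =>
    rw [rolePoly, List.flatMap_cons, List.append_assoc] at hl
    obtain ⟨l₁, l₂, rfl, h₁, h₂⟩ := List.map_eq_append_iff.1 hl
    rw [List.append_assoc] at h ⊢
    have hrest : expEnds ((l₂ ++ rest).map Prod.fst) = 0 := by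
      rw [List.map_append, h₂]; exact expEnds_rolePoly p _
    have htail := ih h₂ h.of_append
    rw [headRegs_roleTerm t h₁ hrest (by rw [htail]; rfl) (by rw [htail]; rfl) h, htail,
      aeval_toPoly, aeval_toPoly, List.map_cons, List.sum_cons, add_comm]
    rfl

theorem operandRegs_roleFormula {n : ℕ} (φ ψ : QFFormula n) {l₁ l₂ : List Cell}
    (h₁ : l₁.map Prod.fst = roleFormula φ) (h₂ : l₂.map Prod.fst = roleFormula ψ) :
    operandRegs (l₁ ++ (l₂ ++ rest)) = headRegs (l₂ ++ rest) := by
  obtain ⟨b, w, hψ, hb⟩ := exists_roleFormula_eq_cons ψ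
  obtain ⟨x, l₂, rfl, rfl, -⟩ := List.map_eq_cons_iff.1 (h₂.trans hψ)
  exact operandRegs_formula h₁ hb _

theorem isTruthValue_headRegs {n : ℕ} (φ : QFFormula n) (hl : l.map Prod.fst = roleFormula φ)
    (h : SolvesAll X (l ++ rest)) :
    IsTruthValue (headRegs (l ++ rest) 0) (φ.Holds (baseValues X n)) := by
  induction φ generalizing l rest with
  | eqZero p =>
    obtain ⟨r, l, rfl, hl, hr, htail⟩ := h.exists_cons hl
    have htruth := isTruthValue_eq_zero_iff.2 ⟨r 1, solves_eqZero.1 hr⟩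
    rwa [headRegs_rolePoly p hl htail] at htruth
  | nonneg p =>
    obtain ⟨r, l, rfl, hl, hr, htail⟩ := h.exists_cons hl
    have htruth := isTruthValue_nonneg_iff.2 ⟨r 1, solves_nonneg.1 hr⟩
    rwa [headRegs_rolePoly p hl htail] at htruth
  | pos p =>
    obtain ⟨r, l, rfl, hl, hr, htail⟩ := h.exists_cons hl
    have htruth := isTruthValue_pos_iff.2 ⟨r 1, solves_pos.1 hr⟩
    rwa [headRegs_rolePoly p hl htail] at htruth
  | not φ ih =>
    obtain ⟨r, l, rfl, hl, hr, htail⟩ := h.exists_cons hl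
    change IsTruthValue (r 0) _
    rw [solves_not.1 hr]
    exact (ih hl htail).not
  | and φ ψ ihφ ihψ | or φ ψ ihφ ihψ =>
    obtain ⟨r, l, rfl, hl, hr, htail⟩ := h.exists_cons hl
    obtain ⟨l₁, l₂, rfl, h₁, h₂⟩ := List.map_eq_append_iff.1 hl
    rw [List.append_assoc] at hr htail
    have hφ := ihφ h₁ htail
    have hψ := ihψ h₂ htail.of_append
    rw [← operandRegs_roleFormula φ ψ h₁ h₂] at hψ
    change IsTruthValue (r 0) _
    first
    | rw [solves_and.1 hr]; exact hφ.and hψ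
    | rw [solves_or.1 hr]; exact hφ.or hψ

end

/-! ### The base of an exponent -/

/-- The letters of the declaration of the variables. -/
def Role.isDeclaration : Role → Bool
  | .start | .tick | .dimSep => true
  | _ => false

theorem Role.ne_of_isDeclaration_eq_false {b : Role} (hb : b.isDeclaration = false) :
    b ≠ .start ∧ b ≠ .tick ∧ b ≠ .dimSep := by
  refine ⟨?_, ?_, ?_⟩ <;> rintro rfl <;> cases hb

theorem envOf_leftScan_append {w : List Role} {vs : List Regs}
    (hw : ∀ b ∈ w, b.isDeclaration = false) (hlen : w.length = vs.length) (c : ℕ)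
    (w' : List Role) (vs' : List Regs) :
    envOf (leftScan false c (w ++ w')) (vs ++ vs') .base =
      envOf (leftScan false c w') vs' .base := by
  induction w generalizing vs with
  | nil =>
    obtain rfl := List.length_eq_zero_iff.1 hlen.symm
    rfl
  | cons b w ih =>
    obtain ⟨hb, hw⟩ := List.forall_mem_cons.1 hw
    obtain ⟨v, vs, rfl⟩ := List.exists_cons_of_length_eq_add_one hlen.symm
    obtain ⟨-, htick, hsep⟩ := Role.ne_of_isDeclaration_eq_false hb
    rw [List.cons_append, List.cons_append, leftScan, envOf_cons]
    simp [htick, hsep, ih hw (Nat.succ.inj hlen)]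

theorem baseRegs_append {pre : List Cell} (hpre : ∀ x ∈ pre, x.1.isDeclaration = false)
    (u : List Cell) : baseRegs (u ++ pre) = baseRegs u := by
  funext c
  rw [baseRegs, List.map_append, List.map_append, List.reverse_append, List.reverse_append,
    envOf_leftScan_append (by simpa using hpre) (by simp)]
  rfl

theorem notMem_leftScan_true (K : Kind) (c : ℕ) (l : List Role) :
    some K ∉ leftScan true c l := by
  induction l generalizing c with
  | nil => simp [leftScan]
  | cons b l ih => simp [leftScan, ih]

theorem envOf_leftScan_replicate_tick {m : ℕ} {vs : List Regs} (hm : m < vs.length)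
    (w : List Role) (vs' : List Regs) :
    envOf (leftScan false m (List.replicate vs.length .tick ++ w)) (vs ++ vs') .base = vs[m] := by
  induction vs generalizing m with
  | nil => simp at hm
  | cons v vs ih =>
    rw [List.length_cons, List.replicate_succ, List.cons_append, List.cons_append, leftScan,
      envOf_cons]
    cases m with
    | zero => simp [envOf_eq_one (notMem_leftScan_true _ _ _)]
    | succ m => simpa using ih (Nat.lt_of_succ_lt_succ hm)

/-- The cells that declare variables with given values. -/
def declaration {n : ℕ} (x : Fin n → ℝ) : List Cell :=
  (List.ofFn x).map fun c => (Role.tick, fun _ => c)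

theorem baseValues_baseRegs_declaration {n : ℕ} (x : Fin n → ℝ) (r₀ r₁ : Regs) :
    baseValues (baseRegs ((Role.start, r₀) :: declaration x ++ [(Role.dimSep, r₁)])) n = x := by
  funext i
  let vs : List Regs := ((List.ofFn x).map fun c => (fun _ => c)).reverse
  have hlen : vs.length = n := by simp [vs]
  have hi : n - i - 1 < vs.length := by omega
  have hticks := envOf_leftScan_replicate_tick hi [Role.start] [r₀]
  have hscan : baseRegs ((Role.start, r₀) :: declaration x ++ [(Role.dimSep, r₁)]) (n - i) =
      envOf (leftScan false (n - i - 1) (List.replicate vs.length Role.tick ++ [Role.start]))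
        (vs ++ [r₀]) .base := by
    simp only [baseRegs, declaration, List.map_append, List.map_cons, List.map_map, List.map_nil,
      List.reverse_append, List.reverse_cons, List.reverse_nil, List.nil_append,
      List.singleton_append, leftScan, envOf_cons, hlen]
    simp [Function.comp_def, vs]
  rw [baseValues, hscan, hticks]
  simp only [vs, List.getElem_reverse, List.length_map, List.length_ofFn, List.getElem_map,
    List.getElem_ofFn]
  congr 1
  ext
  simp only
  omega

/-! ### The sum of the summands -/

/-- The registers of all letters of `l` satisfy their equations, where `l` is preceded by `u`. -/
def SolvesAfter : List Cell → List Cell → Prop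
  | _, [] => True
  | u, x :: l => Solves (baseRegs u) x.1 x.2 l ∧ SolvesAfter (u ++ [x]) l

theorem solvesAfter_append_iff_solvesAll {u pre l : List Cell}
    (hpre : ∀ x ∈ pre, x.1.isDeclaration = false) (hl : ∀ x ∈ l, x.1.isDeclaration = false) :
    SolvesAfter (u ++ pre) l ↔ SolvesAll (baseRegs u) l := by
  induction l generalizing pre with
  | nil => rfl
  | cons x l ih =>
    obtain ⟨hx, hl⟩ := List.forall_mem_cons.1 hl
    rw [SolvesAfter, SolvesAll, baseRegs_append hpre, List.append_assoc, ih _ hl]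
    exact List.forall_mem_append.2 ⟨hpre, List.forall_mem_singleton.2 hx⟩

theorem solvesAfter_of_equations_eq_nil {pre : List Cell} (hpre : ∀ x ∈ pre, equations x.1 = [])
    (u l : List Cell) : SolvesAfter u (pre ++ l) ↔ SolvesAfter (u ++ pre) l := by
  induction pre generalizing u with
  | nil => simp
  | cons x pre ih =>
    obtain ⟨hx, hpre⟩ := List.forall_mem_cons.1 hpre
    rw [List.cons_append, SolvesAfter, ih hpre, List.append_assoc]
    exact and_iff_right (solves_of_equations_eq_nil hx)

/-- The sum of the values of the summands of the letters of `l`, where `l` is preceded by `u`. -/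
noncomputable def total (k : ℕ) : List Cell → List Cell → ℝ
  | _, [] => 0
  | u, x :: l => total k (u ++ [x]) l + evalAt (localEnv (baseRegs u) x.2 l) (summand k x.1)

theorem total_le_zero_and_zero_le_total_iff (k : ℕ) (u : List Cell) {l : List Cell}
    (hl : ∀ x ∈ l, x.1 ≠ .start) : total k u l ≤ 0 ∧ (0 ≤ total k u l ↔ SolvesAfter u l) := by
  induction l generalizing u with
  | nil => simp [total, SolvesAfter]
  | cons x l ih =>
    obtain ⟨hx, hl⟩ := List.forall_mem_cons.1 hl
    obtain ⟨hle, hiff⟩ := ih (u ++ [x]) hl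
    have hnonneg := evalAt_sumSq_nonneg (localEnv (baseRegs u) x.2 l) (equations x.1)
    have hsummand : summand k x.1 = -sumSq (equations x.1) := summand.eq_2 k x.1 hx
    rw [total, hsummand, map_neg, SolvesAfter, ← hiff, Solves, ← evalAt_sumSq_eq_zero]
    refine ⟨by linarith, fun h => ⟨by linarith, by linarith⟩, fun h => ?_⟩
    linarith [h.1, h.2]

theorem one_le_total_iff (k : ℕ) (r : Regs) {l : List Cell} (hl : ∀ x ∈ l, x.1 ≠ .start) :
    1 ≤ total k [] ((.start, r) :: l) ↔ (∃ j < k, r 0 = j) ∧ SolvesAfter [(.start, r)] l := by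
  obtain ⟨hle, hiff⟩ := total_le_zero_and_zero_le_total_iff k [(.start, r)] hl
  have hlevels := evalAt_levels_eq_zero (localEnv (baseRegs []) r l) k
  change _ ↔ ∃ j < k, r 0 = j at hlevels
  rw [← hiff, ← hlevels, total, summand, map_sub, map_one, map_pow, List.nil_append]
  have hsq := sq_nonneg (evalAt (localEnv (baseRegs []) r l) (levels k))
  refine ⟨fun h => ⟨pow_eq_zero_iff two_ne_zero |>.1 (by linarith), by linarith⟩, fun h => ?_⟩
  rw [h.1]
  linarith [h.2]

/-! ### The monomials -/

theorem pre_append_of_mem_picks {α : Type} {n : ℕ} {u v : List α} {p : Pick α n}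
    (hp : p ∈ picks n u v) : p.pre ++ p.letter :: p.post = u ++ v := by
  induction v generalizing u with
  | nil => simp [picks] at hp
  | cons a v ih =>
    rw [picks, List.mem_append, List.mem_map] at hp
    rcases hp with hp | ⟨i, -, rfl⟩
    · simpa using ih hp
    · rfl

/-- The exponents of the monomial `e` in the registers of the kinds of positions, as exponents in
the registers of all positions. -/
def exponents (L : ℕ) (ks : List (Option Kind)) (e : Kind × Fin 3 → ℕ) (i : Fin (L * 3)) : ℕ :=
  (ks.getD (finProdFinEquiv.symm i).1 none).elim 0 fun K => e (K, (finProdFinEquiv.symm i).2)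

/-- The registers of all positions. -/
def regsOf (L : ℕ) (x : Fin (L * 3) → ℝ) : List Regs :=
  List.ofFn fun p : Fin L => fun n => x (finProdFinEquiv (p, n))

theorem length_regsOf (L : ℕ) (x : Fin (L * 3) → ℝ) : (regsOf L x).length = L :=
  List.length_ofFn

theorem exists_regsOf_eq {L : ℕ} {vs : List Regs} (hlen : vs.length = L) :
    ∃ x, regsOf L x = vs := by
  subst hlen
  exact ⟨fun i => vs.get (finProdFinEquiv.symm i).1 (finProdFinEquiv.symm i).2, by simp [regsOf]⟩

theorem prod_getD_eq_prod_zipWith {α β M : Type*} [CommMonoid M] (g : α → β → M) (z : α)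
    {ks : List α} {L : ℕ} (hlen : ks.length = L) (vs : Fin L → β) :
    ∏ p : Fin L, g (ks.getD p z) (vs p) = (List.zipWith g ks (List.ofFn vs)).prod := by
  induction ks generalizing L with
  | nil => subst hlen; simp
  | cons k ks ih =>
    obtain rfl : L = ks.length + 1 := hlen.symm
    rw [Fin.prod_univ_succ, List.ofFn_succ, List.zipWith_cons_cons, List.prod_cons, ← ih rfl]
    simp

theorem prod_zipWith_eq_prod_envOf (e : Kind × Fin 3 → ℕ) (ks : List (Option Kind))
    (vs : List Regs) :
    (List.zipWith (fun (k : Option Kind) (r : Regs) => ∏ n, r n ^ k.elim 0 fun K => e (K, n))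
      ks vs).prod = ∏ K, ∏ n, envOf ks vs K n ^ e (K, n) := by
  induction ks generalizing vs with
  | nil => simp [envOf]
  | cons k ks ih =>
    cases vs with
    | nil => simp [envOf]
    | cons r vs =>
      rw [List.zipWith_cons_cons, List.prod_cons, ih]
      simp only [envOf_cons, Pi.mul_apply, mul_pow, Finset.prod_mul_distrib]
      congr 1
      cases k with
      | none => simp
      | some K₀ =>
        rw [Fintype.prod_eq_single K₀ fun K hK => by simp [Ne.symm hK]]
        simp

theorem prod_pow_exponents {L : ℕ} {ks : List (Option Kind)} (hlen : ks.length = L)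
    (e : Kind × Fin 3 → ℕ) (x : Fin (L * 3) → ℝ) :
    ∏ i, x i ^ exponents L ks e i = ∏ K, ∏ n, envOf ks (regsOf L x) K n ^ e (K, n) := by
  rw [← prod_zipWith_eq_prod_envOf, regsOf, ← prod_getD_eq_prod_zipWith _ none hlen,
    ← Fintype.prod_prod_type']
  exact (Fintype.prod_equiv finProdFinEquiv _ _ fun q => by simp [exponents]).symm

/-- The monomial of a pick. -/
noncomputable def pickTerm (k L : ℕ) (p : Pick Role (width k)) : ℤ × (Fin (L * 3) → ℕ) :=
  ((monoAt k p.letter p.tag).1, exponents L (kinds p.pre p.post) (monoAt k p.letter p.tag).2)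

theorem sum_picks_eq_total (k : ℕ) (u l : List Cell) :
    ((picks (width k) (u.map Prod.fst) (l.map Prod.fst)).map fun p =>
      evalAt (envOf (kinds p.pre p.post) (u.map Prod.snd ++ l.map Prod.snd))
        (monomial (monoAt k p.letter p.tag).2 (monoAt k p.letter p.tag).1)).sum =
      total k u l := by
  induction l generalizing u with
  | nil => rfl
  | cons x l ih =>
    have htail := ih (u ++ [x])
    simp only [List.map_append, List.map_cons, List.map_nil, List.append_assoc,
      List.singleton_append] at htail
    rw [List.map_cons, List.map_cons, picks, List.map_append, List.sum_append, htail, total,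
      ← sum_monomial_monoAt, map_list_sum, List.map_map, List.map_map, ← envOf_kinds]
    refine congrArg₂ (· + ·) rfl (congrArg List.sum (List.map_congr_left fun i hi => ?_))
    have htag : (Fin.ofNat (width k + 1) i : ℕ) = i := Nat.mod_eq_of_lt (List.mem_range.1 hi)
    rw [Function.comp_apply, Function.comp_apply, htag]

theorem aeval_picks (k : ℕ) {l : List Cell} {L : ℕ} (hlen : l.length = L) {x : Fin (L * 3) → ℝ}
    (hx : l.map Prod.snd = regsOf L x) :
    aeval x (PolyCode.toPoly ((picks (width k) [] (l.map Prod.fst)).map (pickTerm k L))) =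
      total k [] l := by
  rw [← sum_picks_eq_total, aeval_toPoly, List.map_map]
  refine congrArg List.sum (List.map_congr_left fun p hp => ?_)
  have hkinds : (kinds p.pre p.post).length = L := by
    rw [length_kinds p.pre p.post p.letter, pre_append_of_mem_picks hp]
    simpa using hlen
  rw [Function.comp_apply, pickTerm, prod_pow_exponents hkinds, evalAt_monomial, List.map_nil,
    List.nil_append, hx]

/-! ### Correctness of the reduction -/

/-- The letters that occur in the word of a sentence but not in that of a formula. -/
def Role.isOuter : Role → Bool
  | .start | .tick | .dimSep | .finish => true
  | _ => false

theorem isOuter_rolePoly {d : ℕ} {p : PolyCode d} {b : Role} (hb : b ∈ rolePoly p) :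
    b.isOuter = false := by
  simp only [rolePoly, roleTerm, roleCoef, roleExponents, List.mem_append, List.mem_flatMap,
    List.mem_cons, List.mem_map, List.not_mem_nil, or_false] at hb
  rcases hb with ⟨_, _, rfl | (hb | ⟨_, _, rfl⟩ | rfl) | ⟨_, _, ⟨_, _, rfl⟩ | rfl⟩⟩ | rfl
  · rfl
  · split_ifs at hb
    · rw [List.mem_singleton.1 hb]; rfl
    · cases hb
  all_goals rfl

theorem isOuter_roleFormula {n : ℕ} {φ : QFFormula n} {b : Role} (hb : b ∈ roleFormula φ) :
    b.isOuter = false := by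
  induction φ with
  | eqZero p | nonneg p | pos p =>
    rcases List.mem_cons.1 hb with rfl | hb
    · rfl
    · exact isOuter_rolePoly hb
  | not φ ih =>
    rcases List.mem_cons.1 hb with rfl | hb
    · rfl
    · exact ih hb
  | and φ ψ ihφ ihψ | or φ ψ ihφ ihψ =>
    rcases List.mem_cons.1 hb with rfl | hb
    · rfl
    · exact (List.mem_append.1 hb).elim ihφ ihψ

theorem isDeclaration_of_mem_roleFormula_append_finish {n : ℕ} {φ : QFFormula n} {b : Role}
    (hb : b ∈ roleFormula φ ++ [.finish]) : b.isDeclaration = false := by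
  rcases List.mem_append.1 hb with hb | hb
  · have houter := isOuter_roleFormula hb
    revert houter
    cases b <;> simp [Role.isOuter, Role.isDeclaration]
  · rw [List.mem_singleton.1 hb]; rfl

section

variable {n : ℕ} {φ : QFFormula n} {t l : List Cell} {r₀ r₁ : Regs}

theorem solvesAfter_start_iff (ht : ∀ x ∈ t, x.1 = .tick)
    (hl : ∀ x ∈ l, x.1.isDeclaration = false) :
    SolvesAfter [(.start, r₀)] (t ++ (.dimSep, r₁) :: l) ↔
      headRegs l 0 = 1 ∧ SolvesAll (baseRegs ((.start, r₀) :: t ++ [(.dimSep, r₁)])) l := by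
  rw [solvesAfter_of_equations_eq_nil (fun x hx => by rw [ht x hx]; rfl), SolvesAfter]
  have hall := solvesAfter_append_iff_solvesAll (u := (.start, r₀) :: t ++ [(.dimSep, r₁)])
    (pre := []) (by simp) hl
  rw [List.append_nil] at hall
  exact and_congr solves_dimSep hall

theorem one_le_total_word_iff (k : ℕ) (ht : ∀ x ∈ t, x.1 = .tick)
    (hl : ∀ x ∈ l, x.1.isDeclaration = false) :
    1 ≤ total k [] ((.start, r₀) :: (t ++ (.dimSep, r₁) :: l)) ↔ (∃ j < k, r₀ 0 = j) ∧
      headRegs l 0 = 1 ∧ SolvesAll (baseRegs ((.start, r₀) :: t ++ [(.dimSep, r₁)])) l := by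
  rw [one_le_total_iff, solvesAfter_start_iff ht hl]
  simp only [List.forall_mem_append, List.forall_mem_cons]
  exact ⟨fun x hx => by simp [ht x hx], by simp,
    fun x hx => (Role.ne_of_isDeclaration_eq_false (hl x hx)).1⟩

theorem isDeclaration_of_map_eq (hl : l.map Prod.fst = roleFormula φ ++ [.finish]) :
    ∀ x ∈ l, x.1.isDeclaration = false := fun _ hx =>
  isDeclaration_of_mem_roleFormula_append_finish (hl ▸ List.mem_map_of_mem hx)

theorem headRegs_eq_one_iff_holds {X : ℕ → Regs}
    (hl : l.map Prod.fst = roleFormula φ ++ [.finish]) (h : SolvesAll X l) :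
    headRegs l 0 = 1 ↔ φ.Holds (baseValues X n) := by
  obtain ⟨l₁, l₂, rfl, h₁, -⟩ := List.map_eq_append_iff.1 hl
  exact (isTruthValue_headRegs φ h₁ h).eq_one_iff

end

/-- The instance of component counting for an existential sentence. The monomial of the first pick
vanishes and is left out: the writer uses this pick to write the dimension and the threshold. -/
noncomputable def reduction (k : ℕ) (s : ExistsSentence) : LevelInstance where
  d := (roleWord s).length * 3
  f := (picks (width k) [] (roleWord s)).tail.map (pickTerm k (roleWord s).length)
  θ := 1
  θ_pos := one_pos

theorem exists_picks_append_singleton {α : Type} (n : ℕ) (u v : List α) (a : α) :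
    ∃ ps, picks n u (v ++ [a]) = ⟨u ++ v, a, 0, []⟩ :: ps ∧
      ∀ p ∈ ps, p.letter = a → p.tag = 0 → a ∈ v := by
  induction v generalizing u with
  | nil =>
    refine ⟨(List.range n).map fun i => ⟨u, a, Fin.ofNat (n + 1) (i + 1), []⟩, ?_, ?_⟩
    · simp only [List.nil_append, picks, List.range_succ_eq_map, List.map_cons, List.map_map,
        List.append_nil]
      rfl
    · intro p hp _ htag
      obtain ⟨i, hi, rfl⟩ := List.mem_map.1 hp
      have hval : (i + 1) % (n + 1) = 0 := congrArg Fin.val htag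
      rw [Nat.mod_eq_of_lt (Nat.succ_lt_succ (List.mem_range.1 hi))] at hval
      cases hval
  | cons b v ih =>
    obtain ⟨ps, hps, hmem⟩ := ih (u ++ [b])
    refine ⟨ps ++ (List.range (n + 1)).map fun i => ⟨u, b, Fin.ofNat (n + 1) i, v ++ [a]⟩, ?_, ?_⟩
    · rw [List.cons_append, picks, hps]; simp
    · intro p hp hletter htag
      rcases List.mem_append.1 hp with hp | hp
      · exact List.mem_cons_of_mem _ (hmem p hp hletter htag)
      · obtain ⟨i, -, rfl⟩ := List.mem_map.1 hp
        exact hletter ▸ List.mem_cons_self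

theorem exists_roleWord_eq (s : ExistsSentence) :
    ∃ w, roleWord s = Role.start :: w ++ [Role.finish] ∧ Role.start ∉ w ∧ Role.finish ∉ w := by
  refine ⟨List.replicate s.n .tick ++ .dimSep :: roleFormula s.matrix, by simp [roleWord], ?_, ?_⟩
  all_goals
    simp only [List.mem_append, List.mem_replicate, List.mem_cons, reduceCtorEq, and_false,
      false_or]
    exact fun h => Bool.noConfusion (isOuter_roleFormula h)

theorem monoAt_finish (k j : ℕ) : (monoAt k .finish j).1 = 0 := by
  simp [monoAt, summand, equations, sumSq]

theorem aeval_reduction (k : ℕ) {s : ExistsSentence} {l : List Cell}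
    (hl : l.map Prod.fst = roleWord s) {x : Fin ((roleWord s).length * 3) → ℝ}
    (hx : l.map Prod.snd = regsOf (roleWord s).length x) :
    aeval x (reduction k s).f.toPoly = total k [] l := by
  have hlen : l.length = (roleWord s).length := by rw [← hl, List.length_map]
  obtain ⟨w, hw, -⟩ := exists_roleWord_eq s
  obtain ⟨ps, hps, -⟩ := exists_picks_append_singleton (width k) [] (Role.start :: w) .finish
  have hpicks : picks (width k) [] (roleWord s) = ⟨Role.start :: w, .finish, 0, []⟩ :: ps := by
    rw [hw, hps, List.nil_append]
  have hfirst : ∀ L, (pickTerm k L ⟨Role.start :: w, .finish, 0, []⟩).1 = 0 := fun _ =>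
    monoAt_finish k 0
  change aeval x (PolyCode.toPoly
    ((picks (width k) [] (roleWord s)).tail.map (pickTerm k (roleWord s).length))) = _
  rw [← aeval_picks k hlen hx, hl, hpicks, List.tail_cons, List.map_cons,
    aeval_toPoly, aeval_toPoly, List.map_cons, List.sum_cons, hfirst, Int.cast_zero, zero_mul,
    zero_add]

theorem mem_superLevel_reduction_iff (k : ℕ) {s : ExistsSentence} {l : List Cell}
    (hl : l.map Prod.fst = roleWord s) {x : Fin ((roleWord s).length * 3) → ℝ}
    (hx : l.map Prod.snd = regsOf (roleWord s).length x) :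
    x ∈ superLevel (reduction k s).f.toPoly ((reduction k s).θ : ℝ) ↔ 1 ≤ total k [] l := by
  rw [← aeval_reduction k hl hx, ← Rat.cast_one]
  rfl

/-- The index of the first register of the first letter. -/
def firstIndex (s : ExistsSentence) : Fin ((roleWord s).length * 3) :=
  finProdFinEquiv (⟨0, Nat.succ_pos _⟩, 0)

theorem apply_firstIndex {s : ExistsSentence} {x : Fin ((roleWord s).length * 3) → ℝ} {r : Regs}
    {vs : List Regs} (hx : r :: vs = regsOf (roleWord s).length x) : x (firstIndex s) = r 0 := by
  have hhead := congrArg (fun vs => (vs.head?.getD 0) 0) hx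
  simpa [regsOf, roleWord, List.ofFn_succ, firstIndex] using hhead.symm

theorem holds_and_level_of_mem_superLevel {k : ℕ} {s : ExistsSentence}
    {x : Fin ((roleWord s).length * 3) → ℝ}
    (hx : x ∈ superLevel (reduction k s).f.toPoly ((reduction k s).θ : ℝ)) :
    (∃ y : Fin s.n → ℝ, s.matrix.Holds y) ∧ ∃ j < k, x (firstIndex s) = j := by
  obtain ⟨l, hfst, hsnd⟩ : ∃ l : List Cell,
      l.map Prod.fst = roleWord s ∧ l.map Prod.snd = regsOf (roleWord s).length x :=
    ⟨(roleWord s).zip (regsOf _ x), List.map_fst_zip (length_regsOf _ x).ge,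
      List.map_snd_zip (length_regsOf _ x).le⟩
  rw [mem_superLevel_reduction_iff k hfst hsnd] at hx
  obtain ⟨⟨_, r₀⟩, l, rfl, rfl, hl⟩ := List.map_eq_cons_iff.1 hfst
  obtain ⟨t, l, rfl, ht, hl⟩ := List.map_eq_append_iff.1 hl
  obtain ⟨⟨_, r₁⟩, l, rfl, rfl, hbody⟩ := List.map_eq_cons_iff.1 hl
  have htick : ∀ x ∈ t, x.1 = .tick := fun x hx =>
    List.eq_of_mem_replicate (ht ▸ List.mem_map_of_mem hx)
  obtain ⟨⟨j, hj, hlevel⟩, hhead, hsolves⟩ :=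
    (one_le_total_word_iff k htick (isDeclaration_of_map_eq hbody)).1 hx
  exact ⟨⟨_, (headRegs_eq_one_iff_holds hbody hsolves).1 hhead⟩, j, hj,
    (apply_firstIndex hsnd).trans hlevel⟩

theorem exists_mem_superLevel_of_holds {k : ℕ} {s : ExistsSentence} {y : Fin s.n → ℝ}
    (hy : s.matrix.Holds y) {j : ℕ} (hj : j < k) :
    ∃ x ∈ superLevel (reduction k s).f.toPoly ((reduction k s).θ : ℝ),
      x (firstIndex s) = j := by
  let r₀ : Regs := fun _ => j
  have hsep : Role.dimSep ∉ roleFormula s.matrix ++ [.finish] := fun h =>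
    Bool.noConfusion (isDeclaration_of_mem_roleFormula_append_finish h)
  obtain ⟨l, hl, hsolves⟩ := exists_solvesAll
    (baseRegs ((Role.start, r₀) :: declaration y ++ [(Role.dimSep, 0)])) hsep
  have hhead : headRegs l 0 = 1 := (headRegs_eq_one_iff_holds hl hsolves).2
    (by rwa [baseValues_baseRegs_declaration])
  have htotal := (one_le_total_word_iff k (by simp [declaration])
    (isDeclaration_of_map_eq hl)).2 ⟨⟨j, hj, rfl⟩, hhead, hsolves⟩
  have hfst : ((Role.start, r₀) :: (declaration y ++ (Role.dimSep, 0) :: l)).map Prod.fst =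
      roleWord s := by
    simp [hl, roleWord, declaration, Function.comp_def]
  obtain ⟨x, hx⟩ := exists_regsOf_eq (L := (roleWord s).length)
    (vs := ((Role.start, r₀) :: (declaration y ++ (Role.dimSep, 0) :: l)).map Prod.snd)
    (by rw [← hfst, List.length_map, List.length_map])
  exact ⟨x, (mem_superLevel_reduction_iff k hfst hx.symm).2 htotal, apply_firstIndex hx.symm⟩

theorem yes_iff_reduction_yes {k : ℕ} (hk : 1 ≤ k) (s : ExistsSentence) :
    ETR.Yes s ↔ (CLSC k).Yes (reduction k s) := by
  constructor
  · rintro ⟨y, hy⟩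
    let levelSet : Set ℝ := Set.range fun j : Fin k => ((j : ℕ) : ℝ)
    let S : Set (Fin ((roleWord s).length * 3) → ℝ) :=
      superLevel (reduction k s).f.toPoly ((reduction k s).θ : ℝ)
    let level : S → levelSet := fun x => ⟨x.1 (firstIndex s),
      let ⟨j, hj, h⟩ := (holds_and_level_of_mem_superLevel x.2).2
      ⟨⟨j, hj⟩, h.symm⟩⟩
    have hcont : Continuous level :=
      ((continuous_apply (firstIndex s)).comp continuous_subtype_val).subtype_mk _
    have hsurj : Function.Surjective level := by
      rintro ⟨_, j, rfl⟩
      obtain ⟨x, hx, h⟩ := exists_mem_superLevel_of_holds hy j.2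
      exact ⟨⟨x, hx⟩, Subtype.ext h⟩
    have hcard : ENat.card levelSet = k := by
      rw [← ENat.card_congr (Equiv.ofInjective (fun j : Fin k => ((j : ℕ) : ℝ))
        (Nat.cast_injective.comp Fin.val_injective))]
      simp
    exact hcard.ge.trans (card_le_numComponents hcont hsurj)
  · intro h
    obtain ⟨x, hx⟩ := one_le_numComponents_iff.1 ((Nat.one_le_cast.2 hk).trans h)
    exact (holds_and_level_of_mem_superLevel hx).1

end Encoding

/-! ### Annotating the letters -/

/-- The part of the word of a sentence in which a letter lies: what has been read so far determines
the role of the bits and separators. -/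
inductive Context
  | first
  | dim
  | coef
  | other
  deriving DecidableEq

instance : Fintype Context := ⟨{.first, .dim, .coef, .other}, fun x => by cases x <;> simp⟩

/-- The context of the next letter. -/
def Context.next (q : Context) : Sym → Context
  | .tick => .dim
  | .sep => .other
  | .term => .coef
  | _ => q

/-- The role of a letter in a context. -/
def Context.role (q : Context) : Sym → Role
  | .bit b => if q = .coef then .coefBit b else .expBit b
  | .tick => .tick
  | .minus => .minus
  | .sep => match q with
    | .first | .dim => .dimSep
    | .coef => .coefSep
    | .other => .expSep
  | .term => .term
  | .endPoly => .endPoly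
  | .eqZero => .eqZero
  | .nonneg => .nonneg
  | .pos => .pos
  | .not => .not
  | .and => .and
  | .or => .or

/-- The transducer that annotates the letters of the word of a sentence. -/
def annotator : CounterTransducer Context Sym Role where
  init := .first
  next q _ x := q.next x
  op _ _ _ := .keep
  out q _ x := (if q = .first then [.start] else []) ++ [q.role x]
  fin _ := [.finish]

/-- The annotated word from a context on. -/
abbrev annotate (q : Context) (l : List Sym) : List Role := annotator.run q 0 l

theorem annotate_cons {q : Context} (hq : q ≠ .first) (x : Sym) (l : List Sym) :
    annotate q (x :: l) = q.role x :: annotate (q.next x) l := by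
  simp [annotate, CounterTransducer.run, annotator, hq, CounterOp.app]

theorem annotate_first_cons (x : Sym) (l : List Sym) :
    annotate .first (x :: l) =
      .start :: Context.role .first x :: annotate (Context.next .first x) l := by
  simp [annotate, CounterTransducer.run, annotator, CounterOp.app]

theorem annotate_coef_encNat (n : ℕ) (l : List Sym) :
    annotate .coef (encNat n ++ l) =
      (Computability.encodeNat n).map .coefBit ++ .coefSep :: annotate .other l := by
  rw [encNat, List.append_assoc]
  induction Computability.encodeNat n with
  | nil => exact annotate_cons (by decide) _ _
  | cons b bs ih => exact (annotate_cons (by decide) _ _).trans (congrArg _ ih)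

theorem annotate_other_encNat (n : ℕ) (l : List Sym) :
    annotate .other (encNat n ++ l) =
      (Computability.encodeNat n).map .expBit ++ .expSep :: annotate .other l := by
  rw [encNat, List.append_assoc]
  induction Computability.encodeNat n with
  | nil => exact annotate_cons (by decide) _ _
  | cons b bs ih => exact (annotate_cons (by decide) _ _).trans (congrArg _ ih)

theorem annotate_encInt (z : ℤ) (l : List Sym) :
    annotate .coef (encInt z ++ l) = roleCoef z ++ annotate .other l := by
  rw [encInt, roleCoef]
  split_ifs
  · rw [List.singleton_append, List.cons_append, annotate_cons (by decide)]
    simp only [Context.role, Context.next, annotate_coef_encNat, List.cons_append,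
      List.append_assoc, List.nil_append]
  · simp only [annotate_coef_encNat, List.nil_append, List.append_assoc, List.singleton_append]

theorem annotate_encNats (es : List ℕ) (l : List Sym) :
    annotate .other (encNats es ++ l) = roleExponents es ++ annotate .other l := by
  induction es with
  | nil => rfl
  | cons e es ih =>
    rw [encNats, List.flatMap_cons, List.append_assoc, annotate_other_encNat, ← encNats, ih,
      roleExponents_cons]
    simp only [List.append_assoc, List.cons_append, List.nil_append]

theorem annotate_encTerm {d : ℕ} (t : ℤ × (Fin d → ℕ)) (l : List Sym) :
    annotate .other (.term :: (encTerm t ++ l)) = roleTerm t ++ annotate .other l := by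
  rw [annotate_cons (by decide), encTerm, List.append_assoc]
  simp only [Context.role, Context.next, annotate_encInt, annotate_encNats, roleTerm,
    List.append_assoc, List.cons_append]

theorem annotate_encPoly {d : ℕ} (p : PolyCode d) (l : List Sym) :
    annotate .other (encPoly p ++ l) = rolePoly p ++ annotate .other l := by
  induction p with
  | nil => exact annotate_cons (by decide) _ _
  | cons t p ih =>
    rw [encPoly, List.flatMap_cons, List.append_assoc, List.append_assoc, List.cons_append,
      annotate_encTerm, rolePoly, List.flatMap_cons, List.append_assoc, List.append_assoc]
    rw [encPoly, rolePoly, List.append_assoc, List.append_assoc] at ih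
    rw [ih]

theorem annotate_encFormula {n : ℕ} (φ : QFFormula n) (l : List Sym) :
    annotate .other (encFormula φ ++ l) = roleFormula φ ++ annotate .other l := by
  induction φ generalizing l with
  | eqZero p | nonneg p | pos p =>
    exact (annotate_cons (by decide) _ _).trans (congrArg _ (annotate_encPoly p l))
  | not φ ih => exact (annotate_cons (by decide) _ _).trans (congrArg _ (ih l))
  | and φ ψ ihφ ihψ | or φ ψ ihφ ihψ =>
    rw [encFormula, roleFormula, List.cons_append, annotate_cons (by decide), List.append_assoc,
      List.cons_append, List.append_assoc, ← ihψ, ← ihφ]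
    rfl

theorem annotate_encDim (n : ℕ) (l : List Sym) :
    annotate .dim (encDim n ++ l) = List.replicate n .tick ++ .dimSep :: annotate .other l := by
  induction n with
  | zero => exact annotate_cons (by decide) _ _
  | succ n ih => exact (annotate_cons (by decide) _ _).trans (congrArg _ ih)

theorem annotate_first_encDim (n : ℕ) (l : List Sym) :
    annotate .first (encDim n ++ l) =
      .start :: (List.replicate n .tick ++ .dimSep :: annotate .other l) := by
  cases n with
  | zero => exact annotate_first_cons _ _
  | succ n =>
    exact (annotate_first_cons _ _).trans (congrArg (_ :: _ :: ·) (annotate_encDim n _))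

theorem annotate_encSentence (s : ExistsSentence) :
    annotate .first (encSentence s) = roleWord s := by
  have hmatrix : roleFormula s.matrix ++ [.finish] = annotate .other (encFormula s.matrix) := by
    conv_rhs => rw [← List.append_nil (encFormula s.matrix), annotate_encFormula]
    rfl
  rw [roleWord, hmatrix, encSentence, annotate_first_encDim]

/-! ### Annotating the positions that matter -/

/-- What the scan to the right of the chosen position has found out about a letter. -/
structure Mark (n : ℕ) extends Sight Role n where
  /-- the kind of the letter; `none` to the left of the chosen position -/
  scanned : Option Kind
  /-- the letter ends an exponent of the current term -/
  counts : Bool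

instance {n : ℕ} : Finite (Mark n) :=
  Finite.of_injective (fun x => (x.toSight, x.scanned, x.counts)) fun x y h => by
    cases x; cases y; simpa using h

/-- The transducer that finds the positions that matter to the right of the chosen one. -/
def rightScanner (n : ℕ) : CounterTransducer Scan (Sight Role n) (Option (Mark n)) where
  init := .init
  next q pos x := match x.side with
    | .left => q
    | .self => .init
    | .right => q.next pos x.letter
  op q _ x := match x.side with
    | .left => .keep
    | .self => .reset
    | .right => q.op x.letter
  out q _ x := match x.side with
    | .left => [some ⟨x, none, false⟩]
    | .self => [some ⟨x, some .self, false⟩]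
    | .right => [some ⟨x, q.kind x.letter, q.counts x.letter⟩]
  fin _ := [none]

/-- The word of a pick after the scan to the right. -/
def Pick.marks {n : ℕ} (p : Pick Role n) : List (Mark n) :=
  p.pre.map (fun b => ⟨⟨b, .left, p.letter, p.tag⟩, none, false⟩) ++
    ⟨⟨p.letter, .self, p.letter, p.tag⟩, some .self, false⟩ ::
    List.zipWith (fun b m => ⟨⟨b, .right, p.letter, p.tag⟩, m.1, m.2⟩) p.post
      (scan .init 0 p.post)

section

variable {n : ℕ} (q : Scan) (c : ℕ)

theorem rightScanner_left (u : List Role) (a : Role) (j : Fin (n + 1)) (w : List (Sight Role n)) :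
    (rightScanner n).run q c (u.map (⟨·, .left, a, j⟩) ++ w) =
      u.map (fun b => some ⟨⟨b, .left, a, j⟩, none, false⟩) ++ (rightScanner n).run q c w := by
  induction u with
  | nil => rfl
  | cons b u ih => exact congrArg (_ :: ·) ih

theorem exists_rightScanner_right (v : List Role) (a : Role) (j : Fin (n + 1))
    (w : List (Sight Role n)) :
    ∃ q' c', (rightScanner n).run q c (v.map (⟨·, .right, a, j⟩) ++ w) =
      List.zipWith (fun b m => some ⟨⟨b, .right, a, j⟩, m.1, m.2⟩) v (scan q c v) ++
        (rightScanner n).run q' c' w := by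
  induction v generalizing q c with
  | nil => exact ⟨q, c, rfl⟩
  | cons b v ih =>
    obtain ⟨q', c', h⟩ := ih (q.next (decide (0 < c)) b) ((q.op b).app c)
    exact ⟨q', c', congrArg (_ :: ·) h⟩

theorem exists_rightScanner_sights (p : Pick Role n) (w : List (Sight Role n)) :
    ∃ q' c', (rightScanner n).run q c (p.sights ++ w) =
      p.marks.map some ++ (rightScanner n).run q' c' w := by
  obtain ⟨q', c', h⟩ := exists_rightScanner_right .init 0 p.post p.letter p.tag w
  refine ⟨q', c', ?_⟩
  rw [Pick.sights, List.append_assoc, rightScanner_left, Pick.marks]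
  simp only [List.map_append, List.map_map, List.map_cons, List.map_zipWith, List.append_assoc,
    List.cons_append]
  exact congrArg (fun l => _ ++ _ :: l) h

theorem rightScanner_flatMap_sights (ps : List (Pick Role n)) :
    (rightScanner n).run q c (ps.flatMap Pick.sights) =
      (ps.flatMap Pick.marks).map some ++ [none] := by
  induction ps generalizing q c with
  | nil => rfl
  | cons p ps ih =>
    obtain ⟨q', c', h⟩ := exists_rightScanner_sights q c p (ps.flatMap Pick.sights)
    rw [List.flatMap_cons, h, ih, List.flatMap_cons, List.map_append, List.append_assoc]

end

/-! ### Writing the polynomial -/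

/-- The part of the output that is written at a letter `b` of kind `K` if `a` is the letter at the
chosen position and `j` its tag. The pick of `finish` with tag `0` yields the dimension and the
threshold, every other pick a term. -/
noncomputable def emit (k : ℕ) (a : Role) (j : Fin (width k + 1)) (b : Role) (K : Option Kind) :
    List Sym :=
  if a = .finish ∧ j = 0 then
    List.replicate 3 .tick ++ if b = .finish then .sep :: encRat 1 else []
  else
    (if b = .start then .term :: encInt (monoAt k a j).1 else []) ++
      encNats (List.ofFn fun n => K.elim 0 fun K => (monoAt k a j).2 (K, n))

/-- The kind of a letter, for a scan to the left in the state `found` with positive counter iff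
`pos`. -/
def Mark.kind {n : ℕ} (x : Mark n) (found pos : Bool) : Option Kind :=
  if x.side = .left then
    if x.letter = .tick ∧ pos = false ∧ found = false then some .base else none
  else x.scanned

/-- The transducer that reads the marks from right to left and writes the polynomial from right to
left. In each pick it counts the ends of exponents on its way to the chosen position and then
performs the scan to the left. -/
noncomputable def writer (k : ℕ) : CounterTransducer Bool (Option (Mark (width k))) Sym where
  init := false
  next found pos := fun
    | none => found
    | some x => if x.letter = .start then false
        else if x.side = .left then found || (decide (x.letter = .tick) && !pos) else found
  op _ _ := fun
    | none => .keep
    | some x => if x.letter = .start then .reset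
        else if x.side = .left then
          if x.letter = .dimSep ∨ x.letter = .tick then .dec else .keep
        else if x.counts then .inc else .keep
  out found pos := fun
    | none => [.endPoly]
    | some x => (emit k x.chosen x.tag x.letter (x.kind found pos)).reverse
  fin _ := []

/-- The part of the output that is written for a pick. -/
noncomputable def Pick.word (k : ℕ) (p : Pick Role (width k)) : List Sym :=
  (List.zipWith (emit k p.letter p.tag) (p.pre ++ p.letter :: p.post)
    (kinds p.pre p.post)).flatten

theorem reverse_flatten_zipWith {α β γ : Type*} (f : α → β → List γ) (l : List α) (l' : List β)
    (h : l.length = l'.length) : (List.zipWith f l l').flatten.reverse =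
      (List.zipWith (fun a b => (f a b).reverse) l.reverse l'.reverse).flatten := by
  rw [List.reverse_flatten, List.map_zipWith, List.reverse_zipWith h]

section

variable {k : ℕ} (found : Bool) (c : ℕ) (a : Role) (j : Fin (width k + 1))

theorem writer_cons (x : Option (Mark (width k))) (w : List (Option (Mark (width k)))) :
    (writer k).run found c (x :: w) = (writer k).out found (decide (0 < c)) x ++
      (writer k).run ((writer k).next found (decide (0 < c)) x)
        (((writer k).op found (decide (0 < c)) x).app c) w := rfl

theorem writer_start (d : Side) (K : Option Kind) (e : Bool)
    (w : List (Option (Mark (width k)))) :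
    (writer k).run found c (some ⟨⟨.start, d, a, j⟩, K, e⟩ :: w) =
      (emit k a j .start (if d = .left then none else K)).reverse ++ (writer k).run false 0 w := by
  rw [writer_cons]
  congr 1

theorem writer_of_side_ne_left {b : Role} (hb : b ≠ .start) {d : Side} (hd : d ≠ .left)
    (K : Option Kind) (e : Bool) (w : List (Option (Mark (width k)))) :
    (writer k).run found c (some ⟨⟨b, d, a, j⟩, K, e⟩ :: w) =
      (emit k a j b K).reverse ++ (writer k).run found (c + if e then 1 else 0) w := by
  rw [writer_cons]
  cases e <;>
    simp only [writer, Mark.kind, hb, hd, if_false, if_true, CounterOp.app, Bool.false_eq_true,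
      add_zero]

theorem writer_left {r : List Role} (hr : Role.start ∉ r) (w : List (Option (Mark (width k)))) :
    (writer k).run found c
        ((r ++ [Role.start]).map (fun b => some ⟨⟨b, .left, a, j⟩, none, false⟩) ++ w) =
      (List.zipWith (fun b K => (emit k a j b K).reverse) (r ++ [Role.start])
        (leftScan found c (r ++ [Role.start]))).flatten ++ (writer k).run false 0 w := by
  induction r generalizing found c with
  | nil =>
    rw [List.nil_append, List.map_singleton, List.singleton_append, writer_start]
    simp [leftScan]
  | cons b r ih =>
    rw [List.mem_cons, not_or] at hr
    have hb : b ≠ .start := Ne.symm hr.1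
    simp only [List.cons_append, List.map_cons, writer_cons, leftScan,
      List.zipWith_cons_cons, List.flatten_cons, List.append_assoc]
    rw [← ih _ _ hr.2]
    congr 1
    · simp [writer, Mark.kind]
    · simp only [writer, hb, if_true, if_false]
      congr 1
      split_ifs <;> rfl

theorem writer_right {v : List Role} (hv : Role.start ∉ v) {ms : List (Option Kind × Bool)}
    (h : v.length = ms.length) (w : List (Option (Mark (width k)))) :
    (writer k).run false c
        (List.zipWith (fun b m => some ⟨⟨b, .right, a, j⟩, m.1, m.2⟩) v ms ++ w) =
      (List.zipWith (fun b m => (emit k a j b m.1).reverse) v ms).flatten ++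
        (writer k).run false (c + ms.countP Prod.snd) w := by
  induction v generalizing c ms with
  | nil => rw [List.length_eq_zero_iff.1 h.symm]; rfl
  | cons b v ih =>
    obtain _ | ⟨⟨K, e⟩, ms⟩ := ms
    · cases h
    rw [List.mem_cons, not_or] at hv
    rw [List.zipWith_cons_cons, List.cons_append,
      writer_of_side_ne_left false c a j (Ne.symm hv.1) (by decide), ih _ hv.2 (Nat.succ.inj h),
      List.zipWith_cons_cons, List.flatten_cons, List.append_assoc, List.countP_cons, add_assoc,
      add_comm (List.countP _ _)]

theorem writer_scan {v : List Role} (hv : Role.start ∉ v) (w : List (Option (Mark (width k)))) :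
    (writer k).run false 0 ((List.zipWith (fun b m => some ⟨⟨b, .right, a, j⟩, m.1, m.2⟩) v
        (scan .init 0 v)).reverse ++ w) =
      (List.zipWith (emit k a j) v ((scan .init 0 v).map Prod.fst)).flatten.reverse ++
        (writer k).run false (expCount v) w := by
  have hlen : v.length = (scan .init 0 v).length := (length_scan _ _ _).symm
  rw [List.zipWith_map_right, reverse_flatten_zipWith _ _ _ hlen, List.reverse_zipWith hlen,
    writer_right 0 a j (by simpa using hv) (by simpa using hlen), List.countP_reverse, zero_add]
  rfl

theorem writer_self_left {u r : List Role} (hu : u ++ [a] = .start :: r) (hr : Role.start ∉ r)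
    (w : List (Option (Mark (width k)))) :
    (writer k).run false c (some ⟨⟨a, .self, a, j⟩, some .self, false⟩ ::
        (u.reverse.map (fun b => some ⟨⟨b, .left, a, j⟩, none, false⟩) ++ w)) =
      ((List.zipWith (emit k a j) u (leftScan false c u.reverse).reverse).flatten ++
        emit k a j a (some .self)).reverse ++ (writer k).run false 0 w := by
  obtain _ | ⟨b, u⟩ := u
  · obtain ⟨rfl, -⟩ := List.cons.inj hu
    rw [writer_start]
    simp
  · obtain ⟨rfl, rfl⟩ := List.cons.inj hu
    have ha : a ≠ .start := fun h => hr (by simp [h])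
    have hstart : Role.start ∉ u.reverse := fun h => hr (by simp [List.mem_reverse.1 h])
    rw [writer_of_side_ne_left false c a j ha (by decide), if_neg Bool.false_ne_true, add_zero,
      List.reverse_append, List.reverse_cons, writer_left false c a j hstart,
      reverse_flatten_zipWith _ _ _ (by simp [length_leftScan]), List.reverse_cons,
      List.reverse_reverse, List.append_assoc]

end

section

variable (k : ℕ)

theorem Pick.word_eq_append (p : Pick Role (width k)) : p.word k =
    ((List.zipWith (emit k p.letter p.tag) p.pre
        (leftScan false (expCount p.post) p.pre.reverse).reverse).flatten ++
      emit k p.letter p.tag p.letter (some .self)) ++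
        (List.zipWith (emit k p.letter p.tag) p.post
          ((scan .init 0 p.post).map Prod.fst)).flatten := by
  rw [Pick.word, kinds, List.zipWith_append (by simp [length_leftScan]), List.flatten_append,
    List.zipWith_cons_cons, List.flatten_cons, List.append_assoc]

theorem writer_marks {p : Pick Role (width k)} {w : List Role}
    (hp : p.pre ++ p.letter :: p.post = .start :: w) (hw : Role.start ∉ w)
    (w' : List (Option (Mark (width k)))) :
    (writer k).run false 0 ((p.marks.map some).reverse ++ w') =
      (p.word k).reverse ++ (writer k).run false 0 w' := by
  obtain ⟨r, hr, rfl⟩ : ∃ r, p.pre ++ [p.letter] = .start :: r ∧ w = r ++ p.post := by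
    rw [List.append_cons] at hp
    obtain ⟨h, -⟩ | ⟨r, hr, hw⟩ := List.append_eq_cons_iff.1 hp
    · simp at h
    · exact ⟨r, hr, hw⟩
  rw [List.mem_append, not_or] at hw
  rw [Pick.word_eq_append, List.reverse_append, List.append_assoc,
    ← writer_self_left _ _ _ hr hw.1, ← writer_scan _ _ hw.2]
  simp [Pick.marks, List.map_zipWith, Function.comp_def]

theorem writer_flatMap_marks {ps : List (Pick Role (width k))} {w : List Role}
    (hps : ∀ p ∈ ps, p.pre ++ p.letter :: p.post = .start :: w) (hw : Role.start ∉ w) :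
    (writer k).run false 0 ((ps.flatMap Pick.marks).map some).reverse =
      (ps.flatMap (Pick.word k)).reverse := by
  suffices h : ∀ w', (writer k).run false 0 (((ps.flatMap Pick.marks).map some).reverse ++ w') =
      (ps.flatMap (Pick.word k)).reverse ++ (writer k).run false 0 w' by
    have hnil := h []
    rw [List.append_nil] at hnil
    exact hnil.trans (List.append_nil _)
  induction ps with
  | nil => exact fun _ => rfl
  | cons p ps ih =>
    intro w'
    rw [List.forall_mem_cons] at hps
    rw [List.flatMap_cons, List.flatMap_cons, List.map_append, List.reverse_append,
      List.reverse_append, List.append_assoc, ih hps.2, writer_marks k hps.1 hw,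
      List.append_assoc]

/-! ### The words of the picks -/

theorem flatten_zipWith_emit_finish {w : List Role} (hw : Role.finish ∉ w)
    {ks : List (Option Kind)} (h : ks.length = w.length) :
    (List.zipWith (emit k .finish 0) w ks).flatten = List.replicate (w.length * 3) .tick := by
  induction w generalizing ks with
  | nil => simp
  | cons b w ih =>
    obtain _ | ⟨K, ks⟩ := ks
    · cases h
    rw [List.mem_cons, not_or] at hw
    have hemit : emit k .finish 0 b K = List.replicate 3 .tick := by simp [emit, Ne.symm hw.1]
    rw [List.zipWith_cons_cons, List.flatten_cons, ih hw.2 (Nat.succ.inj h), hemit,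
      List.length_cons, Nat.succ_mul, Nat.add_comm _ 3, List.replicate_add]

theorem Pick.word_finish {w : List Role} (hw : Role.finish ∉ w) :
    Pick.word k ⟨w, .finish, 0, []⟩ = encDim ((w.length + 1) * 3) ++ encRat 1 := by
  have hemit : emit k .finish 0 .finish (some .self) =
      List.replicate 3 .tick ++ .sep :: encRat 1 := by simp [emit]
  rw [Pick.word_eq_append, flatten_zipWith_emit_finish k hw (by simp [length_leftScan]), hemit,
    encDim, Nat.succ_mul, List.replicate_add]
  simp

theorem ofFn_exponents (ks : List (Option Kind)) (e : Kind × Fin 3 → ℕ) :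
    List.ofFn (exponents ks.length ks e) =
      (ks.map fun K => List.ofFn fun n => K.elim 0 fun K => e (K, n)).flatten := by
  rw [List.ofFn_mul]
  congr 1
  refine List.ext_getElem (by simp) fun i h₁ h₂ => ?_
  have hi : i < ks.length := by simpa using h₁
  simp only [List.getElem_ofFn, List.getElem_map]
  congr 1
  funext n
  have h : finProdFinEquiv.symm (⟨i * 3 + n, by omega⟩ : Fin (ks.length * 3)) = (⟨i, hi⟩, n) := by
    rw [Equiv.symm_apply_eq]
    ext
    simp [finProdFinEquiv, add_comm, mul_comm]
  simp only [exponents, h]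
  simp [hi]

theorem encNats_flatten (l : List (List ℕ)) : encNats l.flatten = (l.map encNats).flatten := by
  induction l with
  | nil => rfl
  | cons a l ih => simp [encNats, ← ih]

theorem zipWith_emit {a : Role} {j : Fin (width k + 1)} (h : ¬ (a = .finish ∧ j = 0))
    {w : List Role} (hw : Role.start ∉ w) {ks : List (Option Kind)} (hks : ks.length = w.length) :
    List.zipWith (emit k a j) w ks =
      ks.map fun K => encNats (List.ofFn fun n => K.elim 0 fun K => (monoAt k a j).2 (K, n)) := by
  induction w generalizing ks with
  | nil => rw [List.length_eq_zero_iff.1 hks]; rfl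
  | cons b w ih =>
    obtain _ | ⟨K, ks⟩ := ks
    · cases hks
    rw [List.mem_cons, not_or] at hw
    rw [List.zipWith_cons_cons, ih hw.2 (Nat.succ.inj hks), List.map_cons, emit, if_neg h,
      if_neg (Ne.symm hw.1), List.nil_append]

theorem Pick.word_eq_encTerm {p : Pick Role (width k)} {w : List Role}
    (hp : p.pre ++ p.letter :: p.post = .start :: w) (hw : Role.start ∉ w)
    (h : ¬ (p.letter = .finish ∧ p.tag = 0)) :
    p.word k = .term :: encTerm (pickTerm k (w.length + 1) p) := by
  have hkinds : (kinds p.pre p.post).length = w.length + 1 := by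
    rw [length_kinds _ _ p.letter, hp, List.length_cons]
  rw [Pick.word, hp, encTerm, pickTerm, ← hkinds, ofFn_exponents, encNats_flatten, List.map_map]
  generalize kinds p.pre p.post = ks at hkinds
  obtain _ | ⟨K, ks⟩ := ks
  · cases hkinds
  rw [List.zipWith_cons_cons, zipWith_emit k h hw (Nat.succ.inj hkinds), List.flatten_cons, emit,
    if_neg h, if_pos rfl]
  simp [Function.comp_def]

theorem encLevel_reduction (s : ExistsSentence) :
    encLevel (reduction k s) =
      (picks (width k) [] (roleWord s)).flatMap (Pick.word k) ++ [.endPoly] := by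
  obtain ⟨w, hword, hstart, hfinish⟩ := exists_roleWord_eq s
  obtain ⟨ps, hps, hletter⟩ := exists_picks_append_singleton (width k) [] (Role.start :: w) .finish
  rw [← hword] at hps
  have hterm : ∀ p ∈ ps, p.word k = .term :: encTerm (pickTerm k (roleWord s).length p) := by
    intro p hp
    have hpre : p.pre ++ p.letter :: p.post = .start :: (w ++ [.finish]) := by
      rw [pre_append_of_mem_picks (hps ▸ List.mem_cons_of_mem _ hp), hword]; rfl
    have hne : ¬ (p.letter = .finish ∧ p.tag = 0) := fun h => by
      simpa [hfinish] using hletter p hp h.1 h.2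
    rw [hword]
    exact Pick.word_eq_encTerm k hpre (by simp [hstart]) hne
  have hlen : (Role.start :: w).length + 1 = (roleWord s).length := by simp [hword]
  simp only [encLevel, reduction, hps, List.tail_cons, List.flatMap_cons, encPoly,
    List.flatMap_map, List.flatMap_congr hterm, List.nil_append]
  rw [Pick.word_finish k (by simp [hfinish]), hlen]
  simp only [List.append_assoc]

theorem writer_rightScanner_annotate (s : ExistsSentence) :
    ((writer k).run (writer k).init 0 ((rightScanner (width k)).run (rightScanner (width k)).init 0
      ((picks (width k) [] (annotate annotator.init (encSentence s))).flatMap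
        Pick.sights)).reverse).reverse = encLevel (reduction k s) := by
  obtain ⟨w, hword, hstart, -⟩ := exists_roleWord_eq s
  have hpicks : ∀ p ∈ picks (width k) [] (roleWord s),
      p.pre ++ p.letter :: p.post = .start :: (w ++ [.finish]) := fun p hp => by
    rw [pre_append_of_mem_picks hp, hword]; rfl
  have hannotate : annotate annotator.init (encSentence s) = roleWord s := annotate_encSentence s
  rw [hannotate, rightScanner_flatMap_sights, List.reverse_append, encLevel_reduction,
    ← List.reverse_inj, List.reverse_reverse, List.reverse_append,
    ← writer_flatMap_marks k hpicks (by simp [hstart])]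
  rfl

theorem polyTime_reduction : PolyTime encSentence encLevel (reduction k) :=
  have : Nonempty Sym := ⟨.tick⟩
  PolyTime.of_comp_encode (((writer k).polyTime_run_reverse.comp
    (rightScanner (width k)).polyTime_run_reverse).comp
      ((polyTime_sights (width k)).comp annotator.polyTime_run))
    (writer_rightScanner_annotate k)

end

theorem existsRHard_CLSC {k : ℕ} (hk : 1 ≤ k) : ExistsRHard (CLSC k) := by
  rintro A ⟨f, hf, h⟩
  exact ⟨reduction k ∘ f, (polyTime_reduction k).comp hf, fun a =>
    (h a).trans (yes_iff_reduction_yes hk (f a))⟩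

end ContinuousClustering

theorem mainTheorem3 (k : ℕ) (hk : 2 ≤ k) :
    ContinuousClustering.ExistsRHard (ContinuousClustering.CLSC k) ∧
    ∀ (m : ℕ) (r : MvPolynomial (Fin m) ℤ),
      -- the two-sheet polynomial
      (ContinuousClustering.superLevel (ContinuousClustering.twoSheet r) 1 =
          ContinuousClustering.sheets r ∧
        (2 ≤ ContinuousClustering.numComponents
            (ContinuousClustering.superLevel (ContinuousClustering.twoSheet r) 1) ↔
          (ContinuousClustering.realZeros r).Nonempty)) ∧
      -- its `k - 1` independent copies
      (ContinuousClustering.superLevel (ContinuousClustering.twoSheetCopies (k - 1) r) 1 =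
          {x | ∀ i : Fin (k - 1), (fun v => x (i, v)) ∈ ContinuousClustering.sheets r} ∧
        ((ContinuousClustering.realZeros r).Nonempty →
          ((2 ^ (k - 1) : ℕ) : ℕ∞) ≤ ContinuousClustering.numComponents
            (ContinuousClustering.superLevel
              (ContinuousClustering.twoSheetCopies (k - 1) r) 1)) ∧
        ((k : ℕ∞) ≤ ContinuousClustering.numComponents
            (ContinuousClustering.superLevel
              (ContinuousClustering.twoSheetCopies (k - 1) r) 1) ↔
          (ContinuousClustering.realZeros r).Nonempty)) := by
  have hk₁ : 1 ≤ k := one_le_two.trans hk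
  have hpow : k ≤ 2 ^ (k - 1) := Nat.le_of_pred_lt Nat.lt_two_pow_self
  refine ⟨ContinuousClustering.existsRHard_CLSC hk₁, fun m r => ?_⟩
  rw [ContinuousClustering.superLevel_twoSheet, ContinuousClustering.superLevel_twoSheetCopies]
  exact ⟨⟨rfl, ContinuousClustering.two_le_numComponents_sheets_iff r⟩, rfl,
    ContinuousClustering.two_pow_le_numComponents_copies r (k - 1),
    ContinuousClustering.le_numComponents_copies_iff r hk₁ (Nat.sub_ne_zero_of_lt hk) hpow⟩
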